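/- **Corollary 3.2.** Let $n,l\ge 1$, $N=nl$, $k\in\mathbb C$ and $\alpha=k+n(l-1)$. Identify $\mathfrak g=\mathfrak{gl}_N$ with $\mathfrak{gl}_l\otimes\mathfrak{gl}_n$ by $e_{ij}\otimes e_{rs}\mapsto e_{(i-1)n+r,\,(j-1)n+s}$, and let $f=\sum_{i=1}^{l-1}e_{i+1\,i}\otimes I_n$, a nilpotent of Jordan type $(l^n)$. With $\deg e_{ij}=j-i$ on $\mathfrak{gl}_l$, put $\mathfrak g_0=\mathfrak l=(\mathfrak{gl}_l)_0\otimes\mathfrak{gl}_n$, $\mathfrak b=\mathfrak{gl}_{l,\le 0}\otimes\mathfrak{gl}_n$ and $\mathfrak m=\mathfrak{gl}_{l,<0}\otimes\mathfrak{gl}_n$. Let $\kappa_{\mathfrak b}(x,y)=\big(\tfrac{k}{2N}+\tfrac12\big)\mathrm{tr}_{\mathfrak g}(\mathrm{ad}\,x\,\mathrm{ad}\,y)-\tfrac12\mathrm{tr}_{\mathfrak g_0}\,p_0(\mathrm{ad}\,x\,\mathrm{ad}\,y)$ on $\mathfrak b$, where $p_0$ is the restriction to $\mathfrak g_0$ along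 the grading; let $V^k(\mathfrak b)\cong \mathrm U(\mathfrak b[t^{-1}]t^{-1})$ be the universal affine vertex algebra of $\mathfrak b$ and $\kappa_{\mathfrak b}$, and $V^k(\mathfrak l)\cong \mathrm U(\mathfrak l[t^{-1}]t^{-1})$ that of $\mathfrak l$ and the restricted form. Write $x[r]=x\,t^r$. *The $W$-algebra.* Let $\mathfrak a$ be the Lie superalgebra with even part $\widehat{\mathfrak b}=\mathfrak b[t,t^{-1}]\oplus\mathbb C\mathbf 1$ (the affinization for $\kappa_{\mathfrak b}$) and supercommutative odd part $\mathfrak m[t,t^{-1}]$, on which $\widehat{\mathfrak b}$ acts by the adjoint action; write $\psi_{ji}[m]\otimes e_{pq}$ for the odd element $e_{ji}t^{m-1}\otimes e_{pq}$. Let $V^k(\mathfrak a)\supset V^k(\mathfrak b)$ be the corresponding vacuum module, a vertex superalgebra. Then $\mathcal W^k(\mathfrak g,f)=\{v\in V^k(\mathfrak b)\mid Qv=0\}$, where $Q$ is the odd derivation commuting with the translation operator whose value on $(e_{ji}[-1]\otimes e_{pq})|0\rangle$, $j\ge i$, is $$\sum_{a=i}^{j-1}\sum_{r=1}^n(e_{ai}[-1]\otimes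 e_{rq})(\psi_{ja}[0]\otimes e_{pr})-\sum_{a=i+1}^{j}\sum_{r=1}^n(\psi_{ai}[0]\otimes e_{rq})(e_{ja}[-1]\otimes e_{pr})+\alpha\,\psi_{ji}[-1]\otimes e_{pq}+\psi_{j+1\,i}[0]\otimes e_{pq}-\psi_{j\,i-1}[0]\otimes e_{pq},$$ with $(-1)$-products, and with $\psi_{ab}=0$ unless $1\le b<a\le l$. The Miura transformation $\nu:\mathcal W^k(\mathfrak g,f)\to V^k(\mathfrak l)$ is the restriction of the homomorphism $V^k(\mathfrak b)\to V^k(\mathfrak l)$ induced by the projection $\mathfrak b\to\mathfrak l$. *The generators.* Make $\mathrm T(\mathfrak{gl}_{l,\le0}[t^{-1}]t^{-1})\otimes\mathbb C[\tau]$ (tensor algebra) an associative algebra by $[\tau,x[-m]]=m\,x[-m-1]$. Let $\mathcal T=(\mathcal T_{ij}):\mathrm T(\mathfrak{gl}_{l,\le0}[t^{-1}]t^{-1})\to M_n\otimes\mathrm U(\mathfrak b[t^{-1}]t^{-1})$ be the algebra homomorphism with $\mathcal T_{ij}(x)=x\otimes e_{ji}$ for $x\in\mathfrak{gl}_{l,\le0}[t^{-1}]t^{-1}$,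 extended by $\mathcal T_{ij}(uS)=\mathcal T_{ij}(u)S$ for $S\in\mathbb C[\tau]$. Let $B$ be the $l\times l$ matrix with $\alpha\tau+e_{aa}[-1]$ on the diagonal, $e_{ab}[-1]$ for $a>b$, $-1$ for $b=a+1$ and $0$ for $b>a+1$; let $\mathrm{cdet}\,B=\sum_{\sigma\in\mathfrak S_l}\mathrm{sgn}\,\sigma\; b_{\sigma(1)1}\cdots b_{\sigma(l)l}$, and define $W^{(r)}_{ij}\in \mathrm U(\mathfrak b[t^{-1}]t^{-1})\cong V^k(\mathfrak b)$ by $$\mathcal T_{ij}(\mathrm{cdet}\,B)=\sum_{r=0}^{l}W^{(r)}_{ij}(\alpha\tau)^{l-r}.$$ (Here $\alpha\tau$ is treated as a variable with $[\alpha\tau,x[-m]]=\alpha m\,x[-m-1]$, so that the coefficients are defined also when $\alpha=0$.) Then, for all $1\le i,j\le n$, the elements $W^{(r)}_{ij}$, $0\le r\le l$, lie in $\mathcal W^k(\mathfrak g,f)$, and in $V^k(\mathfrak l)\otimes\mathbb C[\tau]$ we have $$\sum_{r=0}^{l}\nu(W_{ij}^{(r)})(\alpha\tau)^{l-r}=\mathcal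 T_{ij}\Big(\big(\alpha\tau+e_{11}[-1]\big)\cdots\big(\alpha\tau+e_{ll}[-1]\big)\Big),$$ also with $\alpha\tau$ treated as a variable. -/

import Mathlib

open scoped TensorProduct

noncomputable section

namespace RectW

/-! ## Algebras `A ⊗ ℂ[τ]` with `[τ, a] = d a` -/

section Ore

open Polynomial

/-- A `ℂ`-linear derivation of a (noncommutative) associative algebra. -/
structure Der (A : Type*) [Ring A] [Algebra ℂ A] where
  /-- the underlying linear map -/
  toLin : A →ₗ[ℂ] A
  leibniz : ∀ a b : A, toLin (a * b) = toLin a * b + a * toLin b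

/-- The vector space `A ⊗ ℂ[τ]`; the element `∑ aₛ τˢ` is stored as the polynomial with
coefficients `aₛ` (written to the left of the powers of `τ`).  It is made into an associative
algebra in which `A` and `ℂ[τ]` are subalgebras and `τ a - a τ = d a` for `a ∈ A`. -/
def Ore (A : Type*) [Ring A] [Algebra ℂ A] (_d : Der A) : Type _ := Polynomial A

namespace Ore

variable {A : Type*} [Ring A] [Algebra ℂ A] (d : Der A)

instance : AddCommGroup (Ore A d) := inferInstanceAs (AddCommGroup (Polynomial A))

instance : Module ℂ (Ore A d) := inferInstanceAs (Module ℂ (Polynomial A))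

/-- The derivation acting on coefficients: `∑ aₛ τˢ ↦ ∑ d(aₛ) τˢ`. -/
def coeffD : Polynomial A →ₗ[ℂ] Polynomial A :=
  Polynomial.lsum fun s => (monomial s).restrictScalars ℂ ∘ₗ d.toLin

/-- Left multiplication by `τ` : `τ (∑ aₛ τˢ) = ∑ aₛ τ^{s+1} + ∑ d(aₛ) τˢ`. -/
def tauL : Module.End ℂ (Polynomial A) := LinearMap.mulRight ℂ X + coeffD d

/-- Left multiplication by elements of `A`. -/
def baseL : A →+* Module.End ℂ (Polynomial A) :=
  (Algebra.lmul ℂ (Polynomial A)).toRingHom.comp C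

/-- Left multiplication by `∑ aₛ τˢ`: act by `τ` in total `s` times, then by `aₛ`, and sum. -/
def mulL (p : Polynomial A) : Module.End ℂ (Polynomial A) := p.eval₂ baseL (tauL d)

lemma baseL_apply (a : A) (q : Polynomial A) : baseL a q = C a * q := rfl

lemma coeffD_monomial (s : ℕ) (b : A) : coeffD d (monomial s b) = monomial s (d.toLin b) := by
  simp [coeffD, Polynomial.lsum, Polynomial.sum_monomial_index]

lemma tauL_monomial (s : ℕ) (b : A) :
    tauL d (monomial s b) = monomial (s + 1) b + monomial s (d.toLin b) := by
  simp [tauL, coeffD_monomial, monomial_mul_X]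

lemma tau_base (a : A) : tauL d * baseL a = baseL a * tauL d + baseL (d.toLin a) := by
  refine LinearMap.ext fun q => ?_
  induction q using Polynomial.induction_on' with
  | add p q hp hq => simp only [map_add, hp, hq]
  | monomial s b =>
    simp only [Module.End.mul_apply, LinearMap.add_apply, baseL_apply, C_mul_monomial,
      tauL_monomial, d.leibniz, map_add]
    abel

lemma mulL_monomial (s : ℕ) (b : A) : mulL d (monomial s b) = baseL b * tauL d ^ s := by
  simp [mulL, eval₂_monomial]

lemma mulL_add (p q : Polynomial A) : mulL d (p + q) = mulL d p + mulL d q := by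
  simp [mulL, eval₂_add]

lemma mulL_base (a : A) (q : Polynomial A) : mulL d (baseL a q) = baseL a * mulL d q := by
  induction q using Polynomial.induction_on' with
  | add p q hp hq => simp only [map_add, mulL_add, hp, hq, mul_add]
  | monomial s b => simp [baseL_apply, C_mul_monomial, mulL_monomial, mul_assoc]

lemma mulL_tau (q : Polynomial A) : mulL d (tauL d q) = tauL d * mulL d q := by
  induction q using Polynomial.induction_on' with
  | add p q hp hq => simp only [map_add, mulL_add, hp, hq, mul_add]
  | monomial s b =>
    rw [tauL_monomial, mulL_add, mulL_monomial, mulL_monomial, mulL_monomial, ← mul_assoc,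
      tau_base, add_mul, pow_succ', mul_assoc]

lemma mulL_pow_tau (s : ℕ) (q : Polynomial A) :
    mulL d ((tauL d ^ s) q) = tauL d ^ s * mulL d q := by
  induction s with
  | zero => simp
  | succ s ih => rw [pow_succ', Module.End.mul_apply, mulL_tau, ih, mul_assoc]

lemma mulL_mulL (p q : Polynomial A) : mulL d (mulL d p q) = mulL d p * mulL d q := by
  induction p using Polynomial.induction_on' with
  | add p p' hp hq => simp only [mulL_add, LinearMap.add_apply, hp, hq, add_mul]
  | monomial s b =>
    rw [mulL_monomial, Module.End.mul_apply, mulL_base, mulL_pow_tau, mul_assoc]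

lemma mulL_one : mulL d (1 : Polynomial A) = 1 := by
  simp [mulL]

lemma mulL_apply_one (p : Polynomial A) : mulL d p 1 = p := by
  induction p using Polynomial.induction_on' with
  | add p p' hp hq => simp only [mulL_add, LinearMap.add_apply, hp, hq]
  | monomial s b =>
    have h : ∀ s : ℕ, (tauL d ^ s) (1 : Polynomial A) = monomial s 1 := by
      have h1 : d.toLin 1 = 0 := by
        have := d.leibniz 1 1
        simpa using this
      intro s
      induction s with
      | zero => simp
      | succ s ih => rw [pow_succ', Module.End.mul_apply, ih, tauL_monomial, h1]; simp
    rw [mulL_monomial, Module.End.mul_apply, h, baseL_apply, C_mul_monomial, mul_one]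

instance : Mul (Ore A d) := ⟨fun p q => mulL d (p : Polynomial A) (q : Polynomial A)⟩

instance : One (Ore A d) := ⟨(1 : Polynomial A)⟩

instance : Ring (Ore A d) where
  __ := (inferInstance : AddCommGroup (Ore A d))
  mul_assoc p q r := by
    exact DFunLike.congr_fun (mulL_mulL d p q) r
  one_mul p := by
    exact DFunLike.congr_fun (mulL_one d) p
  mul_one p := mulL_apply_one d p
  left_distrib p q r := (mulL d p).map_add q r
  right_distrib p q r := by
    exact DFunLike.congr_fun (mulL_add d p q) r
  zero_mul p := by
    exact DFunLike.congr_fun (show mulL d (0 : Polynomial A) = 0 by simp [mulL]) p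
  mul_zero p := (mulL d p).map_zero

/-- The embedding `A → A ⊗ ℂ[τ]`. -/
def of (a : A) : Ore A d := (C a : Polynomial A)

/-- The element `τ`. -/
def tau : Ore A d := (X : Polynomial A)

/-- The coefficient `aₛ ∈ A` of `τˢ` in `∑ aₛ τˢ`. -/
def coeff {d : Der A} (s : ℕ) (p : Ore A d) : A := Polynomial.coeff p s

lemma tau_mul_of (a : A) : tau d * of d a = of d a * tau d + of d (d.toLin a) := by
  change mulL d X (C a) = mulL d (C a) X + C (d.toLin a)
  rw [← monomial_zero_left, ← monomial_zero_left, ← monomial_one_one_eq_X, mulL_monomial,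
    mulL_monomial]
  simp [baseL_apply, tauL_monomial, C_mul_monomial, -monomial_zero_left]

end Ore
end Ore

/-! ## Quotients of algebras by left ideals -/

section LQuot

/-- The quotient of a module by a submodule. -/
abbrev SubQuot {A M : Type*} [Ring A] [AddCommGroup M] [Module A M] (J : Submodule A M) : Type _ :=
  M ⧸ J

/-- The left module `A / I`, for a left ideal `I` of a `ℂ`-algebra `A`. -/
def LQuot {A : Type*} [Ring A] (I : Submodule A A) : Type _ := SubQuot I

namespace LQuot

variable {A : Type*} [Ring A] (I : Submodule A A)

instance : AddCommGroup (LQuot I) := inferInstanceAs (AddCommGroup (SubQuot I))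

instance : Module A (LQuot I) := inferInstanceAs (Module A (SubQuot I))

/-- The quotient map. -/
def mk : A →ₗ[A] LQuot I := Submodule.mkQ (M := A) I

variable {I} in
lemma mk_surjective : Function.Surjective (mk I) := Submodule.mkQ_surjective (M := A) I

variable {I} in
lemma mk_eq_zero {u : A} : mk I u = 0 ↔ u ∈ I := Submodule.Quotient.mk_eq_zero (M := A) I

variable [Algebra ℂ A]

instance : Module ℂ (LQuot I) := Module.compHom (LQuot I) (algebraMap ℂ A)

instance : IsScalarTower ℂ A (LQuot I) where
  smul_assoc c a v := by
    rw [Algebra.smul_def, mul_smul]; rfl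

variable {B : Type*} [Ring B] [Algebra ℂ B]

/-- An algebra homomorphism taking a left ideal `I` into a left ideal `J` induces a map of the
quotients. -/
def map (φ : A →ₐ[ℂ] B) (I : Submodule A A) (J : Submodule B B) (h : ∀ u ∈ I, φ u ∈ J) :
    LQuot I →ₗ[ℂ] LQuot J :=
  let F : LQuot I →+ LQuot J := QuotientAddGroup.map I.toAddSubgroup J.toAddSubgroup
    (φ : A →+ B) (fun u hu => h u hu)
  have hF : ∀ u, F (mk I u) = mk J (φ u) := fun _ => rfl
  { toFun := F
    map_add' := F.map_add
    map_smul' := by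
      intro c v
      obtain ⟨u, rfl⟩ := mk_surjective v
      have h1 : c • mk I u = mk I (algebraMap ℂ A c * u) := by
        rw [← smul_eq_mul, map_smul]; rfl
      rw [h1, hF, map_mul, AlgHom.commutes, ← smul_eq_mul, map_smul, hF]
      rfl }

lemma map_mk (φ : A →ₐ[ℂ] B) (I : Submodule A A) (J : Submodule B B) (h : ∀ u ∈ I, φ u ∈ J)
    (u : A) : map φ I J h (mk I u) = mk J (φ u) := rfl

lemma map_smul_alg (φ : A →ₐ[ℂ] B) (I : Submodule A A) (J : Submodule B B)
    (h : ∀ u ∈ I, φ u ∈ J) (a : A) (v : LQuot I) : map φ I J h (a • v) = φ a • map φ I J h v := by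
  obtain ⟨u, rfl⟩ := mk_surjective v
  rw [← map_smul, map_mk, map_mk, smul_eq_mul, map_mul, ← smul_eq_mul, map_smul]

lemma span_le_of_map (φ : A →ₐ[ℂ] B) (S : Set A) (J : Submodule B B) (h : ∀ u ∈ S, φ u ∈ J) :
    ∀ u ∈ Submodule.span A S, φ u ∈ J := by
  intro u hu
  induction hu using Submodule.span_induction with
  | mem x hx => exact h x hx
  | zero => simp
  | add x y _ _ hx hy => rw [map_add]; exact J.add_mem hx hy
  | smul a x _ hx => rw [smul_eq_mul, map_mul]; exact J.smul_mem _ hx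

end LQuot
end LQuot

/-! ## Universal affine vertex algebras, as vacuum modules -/

section Affine

variable {L : Type*} [LieRing L] [LieAlgebra ℂ L]

/-- The relations of the enveloping algebra of `L[t, t⁻¹] ⊕ ℂ 𝟏`, where `𝟏` is set equal to the
unit; the generator `(x, m)` stands for `x[m] = x tᵐ`. -/
inductive AffRel (κ : LinearMap.BilinForm ℂ L) :
    FreeAlgebra ℂ (L × ℤ) → FreeAlgebra ℂ (L × ℤ) → Prop
  | add (x y : L) (m : ℤ) : AffRel κ (FreeAlgebra.ι ℂ (x + y, m))
      (FreeAlgebra.ι ℂ (x, m) + FreeAlgebra.ι ℂ (y, m))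
  | smul (c : ℂ) (x : L) (m : ℤ) : AffRel κ (FreeAlgebra.ι ℂ (c • x, m))
      (c • FreeAlgebra.ι ℂ (x, m))
  | comm (x y : L) (m p : ℤ) : AffRel κ
      (FreeAlgebra.ι ℂ (x, m) * FreeAlgebra.ι ℂ (y, p))
      (FreeAlgebra.ι ℂ (y, p) * FreeAlgebra.ι ℂ (x, m) + FreeAlgebra.ι ℂ (⁅x, y⁆, m + p)
        + algebraMap ℂ _ (if m + p = 0 then (m : ℂ) * κ x y else 0))

/-- The algebra `U(L[t, t⁻¹] ⊕ ℂ 𝟏) / (𝟏 - 1)` for the Kac–Moody affinization of `L` with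
respect to the form `κ`: `[x[m], y[p]] = [x, y][m + p] + m δ_{m+p,0} κ(x, y) 𝟏`. -/
abbrev AffAlg (κ : LinearMap.BilinForm ℂ L) : Type _ := RingQuot (AffRel κ)

/-- The element `x[m]`. -/
def AffAlg.mode (κ : LinearMap.BilinForm ℂ L) (x : L) (m : ℤ) : AffAlg κ :=
  RingQuot.mkAlgHom ℂ (AffRel κ) (FreeAlgebra.ι ℂ (x, m))

lemma AffAlg.mode_add (κ : LinearMap.BilinForm ℂ L) (x y : L) (m : ℤ) :
    mode κ (x + y) m = mode κ x m + mode κ y m := by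
  simpa [mode] using RingQuot.mkAlgHom_rel ℂ (AffRel.add (κ := κ) x y m)

lemma AffAlg.mode_smul (κ : LinearMap.BilinForm ℂ L) (c : ℂ) (x : L) (m : ℤ) :
    mode κ (c • x) m = c • mode κ x m := by
  simpa [mode] using RingQuot.mkAlgHom_rel ℂ (AffRel.smul (κ := κ) c x m)

lemma AffAlg.mode_comm (κ : LinearMap.BilinForm ℂ L) (x y : L) (m p : ℤ) :
    mode κ x m * mode κ y p = mode κ y p * mode κ x m + mode κ ⁅x, y⁆ (m + p)
      + algebraMap ℂ _ (if m + p = 0 then (m : ℂ) * κ x y else 0) := by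
  simpa only [mode, map_mul, map_add, AlgHom.commutes] using
    RingQuot.mkAlgHom_rel ℂ (AffRel.comm (κ := κ) x y m p)

/-- The left ideal generated by `L[t]`. -/
def AffAlg.vacIdeal (κ : LinearMap.BilinForm ℂ L) : Submodule (AffAlg κ) (AffAlg κ) :=
  Submodule.span _ {u | ∃ (x : L) (m : ℤ), 0 ≤ m ∧ u = mode κ x m}

/-- The universal affine vertex algebra of `L` and `κ`, as a module over the affinization: the
module induced from the one-dimensional representation of `L[t] ⊕ ℂ 𝟏` on which `L[t]` acts
by `0` and `𝟏` acts by `1`. -/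
abbrev VAff (κ : LinearMap.BilinForm ℂ L) : Type _ := LQuot (AffAlg.vacIdeal κ)

/-- The vacuum vector. -/
def VAff.vac (κ : LinearMap.BilinForm ℂ L) : VAff κ := LQuot.mk _ 1

variable {L' : Type*} [LieRing L'] [LieAlgebra ℂ L']

/-- `x[m] ↦ f(x)[m]`, for a homomorphism `f` of Lie algebras compatible with the forms. -/
def AffAlg.map {κ : LinearMap.BilinForm ℂ L} {κ' : LinearMap.BilinForm ℂ L'} (f : L →ₗ⁅ℂ⁆ L')
    (hf : ∀ x y, κ' (f x) (f y) = κ x y) : AffAlg κ →ₐ[ℂ] AffAlg κ' :=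
  RingQuot.liftAlgHom ℂ ⟨FreeAlgebra.lift ℂ fun g => mode κ' (f g.1) g.2, by
    intro a b hab
    cases hab with
    | add x y m => simp [mode_add]
    | smul c x m => simp [mode_smul]
    | comm x y m p =>
      simp only [map_mul, map_add, FreeAlgebra.lift_ι_apply, AlgHom.commutes]
      rw [mode_comm, hf, LieHom.map_lie]⟩

lemma AffAlg.map_mode {κ : LinearMap.BilinForm ℂ L} {κ' : LinearMap.BilinForm ℂ L'}
    (f : L →ₗ⁅ℂ⁆ L') (hf : ∀ x y, κ' (f x) (f y) = κ x y) (x : L) (m : ℤ) :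
    AffAlg.map f hf (mode κ x m) = mode κ' (f x) m := by
  simp [AffAlg.map, mode]

lemma AffAlg.map_vacIdeal {κ : LinearMap.BilinForm ℂ L} {κ' : LinearMap.BilinForm ℂ L'}
    (f : L →ₗ⁅ℂ⁆ L') (hf : ∀ x y, κ' (f x) (f y) = κ x y) :
    ∀ u ∈ vacIdeal κ, AffAlg.map f hf u ∈ vacIdeal κ' :=
  LQuot.span_le_of_map _ _ _ (by
    rintro _ ⟨x, m, hm, rfl⟩
    rw [AffAlg.map_mode]
    exact Submodule.subset_span ⟨_, m, hm, rfl⟩)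

/-- The homomorphism of universal affine vertex algebras induced by a homomorphism of Lie
algebras compatible with the forms: `x₁[m₁] ⋯ x_s[m_s] |0⟩ ↦ f(x₁)[m₁] ⋯ f(x_s)[m_s] |0⟩`. -/
def VAff.map {κ : LinearMap.BilinForm ℂ L} {κ' : LinearMap.BilinForm ℂ L'} (f : L →ₗ⁅ℂ⁆ L')
    (hf : ∀ x y, κ' (f x) (f y) = κ x y) : VAff κ →ₗ[ℂ] VAff κ' :=
  LQuot.map (AffAlg.map f hf) _ _ (AffAlg.map_vacIdeal f hf)

lemma VAff.map_vac {κ : LinearMap.BilinForm ℂ L} {κ' : LinearMap.BilinForm ℂ L'}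
    (f : L →ₗ⁅ℂ⁆ L') (hf : ∀ x y, κ' (f x) (f y) = κ x y) :
    VAff.map f hf (VAff.vac κ) = VAff.vac κ' := by
  rw [VAff.map, VAff.vac, LQuot.map_mk, map_one]; rfl

lemma VAff.map_mode {κ : LinearMap.BilinForm ℂ L} {κ' : LinearMap.BilinForm ℂ L'}
    (f : L →ₗ⁅ℂ⁆ L') (hf : ∀ x y, κ' (f x) (f y) = κ x y) (x : L) (m : ℤ) (v : VAff κ) :
    VAff.map f hf (AffAlg.mode κ x m • v) = AffAlg.mode κ' (f x) m • VAff.map f hf v := by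
  rw [VAff.map, LQuot.map_smul_alg, AffAlg.map_mode]

/-- The relations of the enveloping algebra of `L[t⁻¹]t⁻¹`; the generator `(x, s)`, `s ≥ 0`,
stands for `x[-s-1]`. -/
inductive NegRel (L : Type*) [LieRing L] [LieAlgebra ℂ L] :
    FreeAlgebra ℂ (L × ℕ) → FreeAlgebra ℂ (L × ℕ) → Prop
  | add (x y : L) (s : ℕ) : NegRel L (FreeAlgebra.ι ℂ (x + y, s))
      (FreeAlgebra.ι ℂ (x, s) + FreeAlgebra.ι ℂ (y, s))
  | smul (c : ℂ) (x : L) (s : ℕ) : NegRel L (FreeAlgebra.ι ℂ (c • x, s))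
      (c • FreeAlgebra.ι ℂ (x, s))
  | comm (x y : L) (s r : ℕ) : NegRel L
      (FreeAlgebra.ι ℂ (x, s) * FreeAlgebra.ι ℂ (y, r))
      (FreeAlgebra.ι ℂ (y, r) * FreeAlgebra.ι ℂ (x, s) + FreeAlgebra.ι ℂ (⁅x, y⁆, s + r + 1))

/-- The universal enveloping algebra `U(L[t⁻¹]t⁻¹)`. -/
abbrev UNeg (L : Type*) [LieRing L] [LieAlgebra ℂ L] : Type _ := RingQuot (NegRel L)

/-- The element `x[-s-1]`. -/
def UNeg.gen (x : L) (s : ℕ) : UNeg L :=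
  RingQuot.mkAlgHom ℂ (NegRel L) (FreeAlgebra.ι ℂ (x, s))

lemma UNeg.gen_add (x y : L) (s : ℕ) : gen (x + y) s = gen x s + gen y s := by
  simpa [gen] using RingQuot.mkAlgHom_rel ℂ (NegRel.add x y s)

lemma UNeg.gen_smul (c : ℂ) (x : L) (s : ℕ) : gen (c • x) s = c • gen x s := by
  simpa [gen] using RingQuot.mkAlgHom_rel ℂ (NegRel.smul c x s)

/-- The homomorphism `U(L[t⁻¹]t⁻¹) → U(L[t, t⁻¹] ⊕ ℂ 𝟏) / (𝟏 - 1)`. -/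
def UNeg.toAff (κ : LinearMap.BilinForm ℂ L) : UNeg L →ₐ[ℂ] AffAlg κ :=
  RingQuot.liftAlgHom ℂ ⟨FreeAlgebra.lift ℂ fun g => AffAlg.mode κ g.1 (-(g.2 : ℤ) - 1), by
    intro a b hab
    cases hab with
    | add x y m => simp [AffAlg.mode_add]
    | smul c x m => simp [AffAlg.mode_smul]
    | comm x y s r =>
      simp only [map_mul, map_add, FreeAlgebra.lift_ι_apply]
      rw [AffAlg.mode_comm, if_neg (by omega), map_zero, add_zero]
      congr 2
      push_cast
      ring⟩

/-- The identification `U(L[t⁻¹]t⁻¹) → V(L)`, `u ↦ u |0⟩`. -/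
def UNeg.toVac (κ : LinearMap.BilinForm ℂ L) : UNeg L →ₗ[ℂ] VAff κ where
  toFun u := UNeg.toAff κ u • VAff.vac κ
  map_add' u v := by rw [map_add, add_smul]
  map_smul' c u := by rw [map_smul, smul_assoc]; rfl

end Affine

/-! ## The Lie algebras -/

section Rect

-- the commutator bracket on matrices
attribute [local instance] LieRing.ofAssociativeRing

variable (n l : ℕ)

/-- The index set `{1, …, l} × {1, …, n}` of the rows and columns of `gl_N = gl_l ⊗ gl_n`,
`N = n l`; the pair `(i, r)` is the number `(i - 1) n + r`. -/
abbrev Idx : Type := Fin l × Fin n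

/-- `g = gl_N = gl_l ⊗ gl_n`, with `e_{ij} ⊗ e_{rs}` the matrix unit at `((i, r), (j, s))`. -/
abbrev Gl : Type := Matrix (Idx n l) (Idx n l) ℂ

variable {n l} in
lemma lower_mul {x y : Gl n l} (hx : ∀ a c, a.1 < c.1 → x a c = 0)
    (hy : ∀ a c, a.1 < c.1 → y a c = 0) : ∀ a c, a.1 < c.1 → (x * y) a c = 0 := by
  intro a c hac
  rw [Matrix.mul_apply]
  refine Finset.sum_eq_zero fun d _ => ?_
  rcases lt_or_ge a.1 d.1 with h | h
  · rw [hx a d h, zero_mul]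
  · rw [hy d c (lt_of_le_of_lt h hac), mul_zero]

variable {n l} in
lemma diag_mul {x y : Gl n l} (hx : ∀ a c, a.1 ≠ c.1 → x a c = 0)
    (hy : ∀ a c, a.1 ≠ c.1 → y a c = 0) : ∀ a c, a.1 ≠ c.1 → (x * y) a c = 0 := by
  intro a c hac
  rw [Matrix.mul_apply]
  refine Finset.sum_eq_zero fun d _ => ?_
  by_cases h : a.1 = d.1
  · rw [hy d c (h ▸ hac), mul_zero]
  · rw [hx a d h, zero_mul]

/-- `b = gl_{l,≤0} ⊗ gl_n`: the span of the `e_{ji} ⊗ e_{pq}` with `j ≥ i`. -/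
def bAlg : LieSubalgebra ℂ (Gl n l) where
  carrier := {x | ∀ a c, a.1 < c.1 → x a c = 0}
  add_mem' hx hy a c h := by simp [hx a c h, hy a c h]
  zero_mem' _ _ _ := rfl
  smul_mem' r _ hx a c h := by simp [hx a c h]
  lie_mem' {x y} hx hy a c h := by
    rw [Ring.lie_def, Matrix.sub_apply, lower_mul hx hy a c h, lower_mul hy hx a c h, sub_zero]

/-- `l = (gl_l)_0 ⊗ gl_n`: the block diagonal matrices. -/
def lAlg : LieSubalgebra ℂ (Gl n l) where
  carrier := {x | ∀ a c, a.1 ≠ c.1 → x a c = 0}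
  add_mem' hx hy a c h := by simp [hx a c h, hy a c h]
  zero_mem' _ _ _ := rfl
  smul_mem' r _ hx a c h := by simp [hx a c h]
  lie_mem' {x y} hx hy a c h := by
    rw [Ring.lie_def, Matrix.sub_apply, diag_mul hx hy a c h, diag_mul hy hx a c h, sub_zero]

/-- `m = gl_{l,<0} ⊗ gl_n`: the span of the `e_{ji} ⊗ e_{pq}` with `j > i`. -/
def mAlg : Submodule ℂ (Gl n l) where
  carrier := {x | ∀ a c, a.1 ≤ c.1 → x a c = 0}
  add_mem' hx hy a c h := by simp [hx a c h, hy a c h]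
  zero_mem' _ _ _ := rfl
  smul_mem' r _ hx a c h := by simp [hx a c h]

lemma l_le_b : lAlg n l ≤ bAlg n l := fun _ hx a c h => hx a c h.ne

variable {n l} in
/-- The adjoint action of `b` on its ideal `m`. -/
def adM (x : bAlg n l) (y : mAlg n l) : mAlg n l :=
  ⟨⁅(x : Gl n l), (y : Gl n l)⁆, by
    intro a c hac
    rw [Ring.lie_def, Matrix.sub_apply, Matrix.mul_apply, Matrix.mul_apply,
      Finset.sum_eq_zero, Finset.sum_eq_zero, sub_zero]
    · intro d _
      rcases le_or_gt a.1 d.1 with h | h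
      · rw [y.2 a d h, zero_mul]
      · rw [x.2 d c (lt_of_lt_of_le h hac), mul_zero]
    · intro d _
      rcases lt_or_ge a.1 d.1 with h | h
      · rw [x.2 a d h, zero_mul]
      · rw [y.2 d c (h.trans hac), mul_zero]⟩

/-- The projection `g → g_0` along the other graded components. -/
def p0 : Gl n l →ₗ[ℂ] Gl n l where
  toFun x := Matrix.of fun a c => if a.1 = c.1 then x a c else 0
  map_add' x y := by ext a c; by_cases h : a.1 = c.1 <;> simp [h]
  map_smul' r x := by ext a c; by_cases h : a.1 = c.1 <;> simp [h]

variable {n l} in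
lemma p0_apply (x : Gl n l) (a c : Idx n l) : p0 n l x a c = if a.1 = c.1 then x a c else 0 := rfl

variable {n l} in
lemma p0_mul {x y : Gl n l} (hx : x ∈ bAlg n l) (hy : y ∈ bAlg n l) :
    p0 n l (x * y) = p0 n l x * p0 n l y := by
  ext a c
  rw [p0_apply, Matrix.mul_apply, Matrix.mul_apply]
  simp only [p0_apply]
  split_ifs with h
  · refine Finset.sum_congr rfl fun d _ => ?_
    rcases lt_trichotomy a.1 d.1 with h1 | h1 | h1
    · rw [hx a d h1]; simp
    · simp [h1, h1.symm.trans h]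
    · rw [hy d c (h ▸ h1)]; simp
  · refine (Finset.sum_eq_zero fun d _ => ?_).symm
    by_cases h1 : a.1 = d.1
    · rw [if_neg (fun h2 => h (h1.trans h2)), mul_zero]
    · rw [if_neg h1, zero_mul]

/-- The projection `b → l`, a homomorphism of Lie algebras. -/
def proj : bAlg n l →ₗ⁅ℂ⁆ lAlg n l where
  toFun x := ⟨p0 n l x, fun _ _ h => if_neg h⟩
  map_add' x y := Subtype.ext (map_add (p0 n l) x.1 y.1)
  map_smul' r x := Subtype.ext (map_smul (p0 n l) r x.1)
  map_lie' {x y} := Subtype.ext (by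
    change p0 n l ⁅x.1, y.1⁆ = ⁅p0 n l x.1, p0 n l y.1⁆
    rw [Ring.lie_def, Ring.lie_def, map_sub, p0_mul x.2 y.2, p0_mul y.2 x.2])

/-- The form `(x, y) ↦ tr_{g_0} p_0 (ad x ad y)` on `g`.  As `p_0` is the projection onto `g_0`,
the trace over `g_0` is the trace over `g` of `p_0 ∘ ad x ∘ ad y`. -/
def traceG0 : LinearMap.BilinForm ℂ (Gl n l) :=
  LinearMap.mk₂ ℂ
    (fun x y => LinearMap.trace ℂ (Gl n l)
      (p0 n l ∘ₗ (LieAlgebra.ad ℂ (Gl n l) x) ∘ₗ (LieAlgebra.ad ℂ (Gl n l) y)))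
    (fun x x' y => by simp only [map_add, LinearMap.add_comp, LinearMap.comp_add])
    (fun c x y => by simp only [map_smul, LinearMap.smul_comp, LinearMap.comp_smul])
    (fun x y y' => by simp only [map_add, LinearMap.comp_add])
    (fun c x y => by simp only [map_smul, LinearMap.comp_smul])

/-- The normalized Killing form `κ(x, y) = (k / 2N) tr_g (ad x ad y)` on `g`, `N = n l`. -/
def kappa (k : ℂ) : LinearMap.BilinForm ℂ (Gl n l) :=
  (k / (2 * ((n * l : ℕ) : ℂ))) • killingForm ℂ (Gl n l)

/-- The form `κ_b(x, y) = κ(x, y) + ½ tr_g (ad x ad y) - ½ tr_{g_0} p_0 (ad x ad y)`. -/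
def kappaB (k : ℂ) : LinearMap.BilinForm ℂ (Gl n l) :=
  kappa n l k + (1 / 2 : ℂ) • killingForm ℂ (Gl n l) - (1 / 2 : ℂ) • traceG0 n l

/-- `κ_b` as a form on `b`. -/
def formB (k : ℂ) : LinearMap.BilinForm ℂ (bAlg n l) :=
  LinearMap.mk₂ ℂ (fun x y => kappaB n l k x y) (by simp) (by simp) (by simp) (by simp)

/-- The restriction of `κ_b` to `l ⊆ b`. -/
def formL (k : ℂ) : LinearMap.BilinForm ℂ (lAlg n l) :=
  LinearMap.mk₂ ℂ (fun x y => kappaB n l k x y) (by simp) (by simp) (by simp) (by simp)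

variable {n l} in
lemma trace_eq (F : Gl n l →ₗ[ℂ] Gl n l) :
    LinearMap.trace ℂ (Gl n l) F = ∑ a, ∑ c, F (Matrix.single a c 1) a c := by
  rw [LinearMap.trace_eq_matrix_trace ℂ (Matrix.stdBasis ℂ (Idx n l) (Idx n l)), Matrix.trace,
    Fintype.sum_prod_type]
  refine Finset.sum_congr rfl fun a _ => Finset.sum_congr rfl fun c _ => ?_
  rw [Matrix.diag_apply, LinearMap.toMatrix_apply, Matrix.stdBasis_eq_single]
  rfl

variable {n l} in
lemma ad_ad_single (x y : Gl n l) (a c : Idx n l) :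
    (LieAlgebra.ad ℂ (Gl n l) x (LieAlgebra.ad ℂ (Gl n l) y (Matrix.single a c 1))) a c
      = (x * y) a a - x a a * y c c - y a a * x c c + (y * x) c c := by
  simp only [LieAlgebra.ad_apply, Ring.lie_def, mul_sub, sub_mul, Matrix.sub_apply]
  rw [← mul_assoc x y, ← mul_assoc x _ y, mul_assoc _ y x, Matrix.mul_single_apply_same,
    Matrix.single_mul_apply_same, mul_assoc x _ y, mul_assoc y _ x]
  simp [Matrix.mul_apply, Matrix.single_apply, Finset.sum_ite_eq, ite_and]
  ring

variable {n l} in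
lemma mul_diag_entry {x y : Gl n l} (hx : x ∈ bAlg n l) (hy : y ∈ bAlg n l) (a : Idx n l) :
    (p0 n l x * p0 n l y) a a = (x * y) a a := by
  rw [← p0_mul hx hy, p0_apply, if_pos rfl]

variable {n l} in
lemma killing_p0 {x y : Gl n l} (hx : x ∈ bAlg n l) (hy : y ∈ bAlg n l) :
    killingForm ℂ (Gl n l) (p0 n l x) (p0 n l y) = killingForm ℂ (Gl n l) x y := by
  rw [killingForm_apply_apply, killingForm_apply_apply, trace_eq, trace_eq]
  refine Finset.sum_congr rfl fun a _ => Finset.sum_congr rfl fun c _ => ?_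
  rw [LinearMap.comp_apply, LinearMap.comp_apply, ad_ad_single, ad_ad_single,
    mul_diag_entry hx hy, mul_diag_entry hy hx]
  simp [p0_apply]

variable {n l} in
lemma traceG0_p0 {x y : Gl n l} (hx : x ∈ bAlg n l) (hy : y ∈ bAlg n l) :
    traceG0 n l (p0 n l x) (p0 n l y) = traceG0 n l x y := by
  rw [traceG0, LinearMap.mk₂_apply, LinearMap.mk₂_apply, trace_eq, trace_eq]
  refine Finset.sum_congr rfl fun a _ => Finset.sum_congr rfl fun c _ => ?_
  simp only [LinearMap.comp_apply]
  rw [p0_apply, p0_apply, ad_ad_single, ad_ad_single,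
    mul_diag_entry hx hy, mul_diag_entry hy hx]
  simp [p0_apply]

/-- The projection `b → l` is compatible with the forms. -/
lemma form_proj (k : ℂ) (x y : bAlg n l) :
    formL n l k (proj n l x) (proj n l y) = formB n l k x y := by
  change kappaB n l k (p0 n l x.1) (p0 n l y.1) = kappaB n l k x.1 y.1
  simp only [kappaB, kappa, LinearMap.add_apply, LinearMap.sub_apply, LinearMap.smul_apply,
    killing_p0 x.2 y.2, traceG0_p0 x.2 y.2]

/-- The universal affine vertex algebra `V^k(b)`. -/
abbrev Vb (k : ℂ) : Type _ := VAff (formB n l k)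

/-- The universal affine vertex algebra `V^k(l)`. -/
abbrev Vl (k : ℂ) : Type _ := VAff (formL n l k)

/-- The map `V^k(b) → V^k(l)` induced by the projection `b → l`. -/
def nu (k : ℂ) : Vb n l k →ₗ[ℂ] Vl n l k := VAff.map (proj n l) (form_proj n l k)

/-- The map `V^k(l) → V^k(b)` induced by the inclusion `l ⊆ b`; under the identifications
`V^k(l) = U(l[t⁻¹]t⁻¹)` and `V^k(b) = U(b[t⁻¹]t⁻¹)` it is the inclusion of the subalgebra. -/
def inclVl (k : ℂ) : Vl n l k →ₗ[ℂ] Vb n l k :=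
  VAff.map (LieSubalgebra.inclusion (l_le_b n l)) (fun _ _ => rfl)

lemma nu_inclVl (k : ℂ) (v : Vl n l k) : nu n l k (inclVl n l k v) = v := by
  have hproj : ∀ x : lAlg n l, proj n l (LieSubalgebra.inclusion (l_le_b n l) x) = x := by
    intro x
    refine Subtype.ext (Matrix.ext fun a c => ?_)
    change (if a.1 = c.1 then x.1 a c else 0) = x.1 a c
    split_ifs with h
    · rfl
    · exact (x.2 a c h).symm
  have key : ((AffAlg.map (proj n l) (form_proj n l k)).comp
      (AffAlg.map (κ := formL n l k) (κ' := formB n l k)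
        (LieSubalgebra.inclusion (l_le_b n l)) (fun _ _ => rfl))) = AlgHom.id ℂ _ := by
    refine RingQuot.ringQuot_ext' _ _ _ (FreeAlgebra.hom_ext (funext fun g => ?_))
    refine (congrArg (AffAlg.map (proj n l) (form_proj n l k)) (AffAlg.map_mode (κ := formL n l k)
      (κ' := formB n l k) (LieSubalgebra.inclusion (l_le_b n l)) (fun _ _ => rfl) g.1 g.2)).trans ?_
    rw [AffAlg.map_mode, hproj]
    rfl
  obtain ⟨u, rfl⟩ := LQuot.mk_surjective v
  exact congrArg (LQuot.mk _) (DFunLike.congr_fun key u)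

lemma inclVl_injective (k : ℂ) : Function.Injective (inclVl n l k) :=
  Function.LeftInverse.injective (nu_inclVl n l k)

/-! ## The vertex superalgebra `V^k(a)` and the differential `Q` -/

/-- Generators of the enveloping algebra of the Lie superalgebra `a`: `ev x m` is the even
element `x tᵐ`, `x ∈ b`, and `od y m` is the odd element `y tᵐ`, `y ∈ m`. -/
inductive GenA
  | ev (x : bAlg n l) (m : ℤ)
  | od (y : mAlg n l) (m : ℤ)

/-- The relations of the enveloping algebra of the Lie superalgebra
`a = (b[t, t⁻¹] ⊕ ℂ 𝟏) ⊕ m[t, t⁻¹]`, with `𝟏` set equal to the unit. -/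
inductive RelA (k : ℂ) :
    FreeAlgebra ℂ (GenA n l) → FreeAlgebra ℂ (GenA n l) → Prop
  | ev_add (x y : bAlg n l) (m : ℤ) : RelA k (FreeAlgebra.ι ℂ (.ev (x + y) m))
      (FreeAlgebra.ι ℂ (.ev x m) + FreeAlgebra.ι ℂ (.ev y m))
  | ev_smul (c : ℂ) (x : bAlg n l) (m : ℤ) : RelA k (FreeAlgebra.ι ℂ (.ev (c • x) m))
      (c • FreeAlgebra.ι ℂ (.ev x m))
  | od_add (x y : mAlg n l) (m : ℤ) : RelA k (FreeAlgebra.ι ℂ (.od (x + y) m))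
      (FreeAlgebra.ι ℂ (.od x m) + FreeAlgebra.ι ℂ (.od y m))
  | od_smul (c : ℂ) (x : mAlg n l) (m : ℤ) : RelA k (FreeAlgebra.ι ℂ (.od (c • x) m))
      (c • FreeAlgebra.ι ℂ (.od x m))
  | ev_ev (x y : bAlg n l) (m p : ℤ) : RelA k
      (FreeAlgebra.ι ℂ (.ev x m) * FreeAlgebra.ι ℂ (.ev y p))
      (FreeAlgebra.ι ℂ (.ev y p) * FreeAlgebra.ι ℂ (.ev x m) + FreeAlgebra.ι ℂ (.ev ⁅x, y⁆ (m + p))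
        + algebraMap ℂ _ (if m + p = 0 then (m : ℂ) * formB n l k x y else 0))
  | ev_od (x : bAlg n l) (y : mAlg n l) (m p : ℤ) : RelA k
      (FreeAlgebra.ι ℂ (.ev x m) * FreeAlgebra.ι ℂ (.od y p))
      (FreeAlgebra.ι ℂ (.od y p) * FreeAlgebra.ι ℂ (.ev x m) + FreeAlgebra.ι ℂ (.od (adM x y) (m + p)))
  | od_od (x y : mAlg n l) (m p : ℤ) : RelA k
      (FreeAlgebra.ι ℂ (.od x m) * FreeAlgebra.ι ℂ (.od y p)
        + FreeAlgebra.ι ℂ (.od y p) * FreeAlgebra.ι ℂ (.od x m)) 0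

/-- The algebra `U(a) / (𝟏 - 1)`. -/
abbrev UA (k : ℂ) : Type _ := RingQuot (RelA n l k)

/-- The even element `x[m] = x tᵐ`, `x ∈ b`. -/
def evA (k : ℂ) (x : bAlg n l) (m : ℤ) : UA n l k :=
  RingQuot.mkAlgHom ℂ (RelA n l k) (FreeAlgebra.ι ℂ (.ev x m))

/-- The odd element `y tᵐ`, `y ∈ m`. -/
def odA (k : ℂ) (y : mAlg n l) (m : ℤ) : UA n l k :=
  RingQuot.mkAlgHom ℂ (RelA n l k) (FreeAlgebra.ι ℂ (.od y m))

/-- The left ideal generated by `b[t]` and `m[t]`. -/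
def vacIdealA (k : ℂ) : Submodule (UA n l k) (UA n l k) :=
  Submodule.span _ {u | (∃ (x : bAlg n l) (m : ℤ), 0 ≤ m ∧ u = evA n l k x m) ∨
    ∃ (y : mAlg n l) (m : ℤ), 0 ≤ m ∧ u = odA n l k y m}

/-- `V^k(a)`: the module induced from the one-dimensional representation on which `b[t]` and
`m[t]` act by `0` and `𝟏` acts by `1`. -/
abbrev Va (k : ℂ) : Type _ := LQuot (vacIdealA n l k)

/-- The vacuum vector of `V^k(a)`. -/
def vacA (k : ℂ) : Va n l k := LQuot.mk _ 1

/-- `x[m] ↦ x[m]`. -/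
def affToUA (k : ℂ) : AffAlg (formB n l k) →ₐ[ℂ] UA n l k :=
  RingQuot.liftAlgHom ℂ ⟨FreeAlgebra.lift ℂ fun g => evA n l k g.1 g.2, by
    intro a b hab
    cases hab with
    | add x y m => simpa [evA] using RingQuot.mkAlgHom_rel ℂ (RelA.ev_add (k := k) x y m)
    | smul c x m => simpa [evA] using RingQuot.mkAlgHom_rel ℂ (RelA.ev_smul (k := k) c x m)
    | comm x y m p =>
      simpa only [evA, map_mul, map_add, FreeAlgebra.lift_ι_apply, AlgHom.commutes] using
        RingQuot.mkAlgHom_rel ℂ (RelA.ev_ev (k := k) x y m p)⟩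

lemma affToUA_mode (k : ℂ) (x : bAlg n l) (m : ℤ) :
    affToUA n l k (AffAlg.mode _ x m) = evA n l k x m := by
  simp [affToUA, AffAlg.mode]

lemma affToUA_vacIdeal (k : ℂ) :
    ∀ u ∈ AffAlg.vacIdeal (formB n l k), affToUA n l k u ∈ vacIdealA n l k :=
  LQuot.span_le_of_map _ _ _ (by
    rintro _ ⟨x, m, hm, rfl⟩
    rw [affToUA_mode]
    exact Submodule.subset_span (Or.inl ⟨_, m, hm, rfl⟩))

/-- The embedding `V^k(b) → V^k(a)`. -/
def VbToVa (k : ℂ) : Vb n l k →ₗ[ℂ] Va n l k := LQuot.map (affToUA n l k) _ _ (affToUA_vacIdeal n l k)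

/-- The element `e_{ji} ⊗ e_{pq}` of `b`; it is `0` if `j < i`. -/
def eB (j i : Fin l) (p q : Fin n) : bAlg n l :=
  if h : i ≤ j then ⟨Matrix.single (j, p) (i, q) 1, by
    intro a c hac
    rw [Matrix.single_apply, if_neg]
    rintro ⟨rfl, rfl⟩
    exact absurd h (not_le.mpr hac)⟩
  else 0

/-- The element `e_{ji} ⊗ e_{pq}` of `m`; it is `0` if `j ≤ i`. -/
def eM (j i : Fin l) (p q : Fin n) : mAlg n l :=
  if h : i < j then ⟨Matrix.single (j, p) (i, q) 1, by
    intro a c hac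
    rw [Matrix.single_apply, if_neg]
    rintro ⟨rfl, rfl⟩
    exact absurd h (not_lt.mpr hac)⟩
  else 0

/-- `e_{ji}[m] ⊗ e_{pq}`. -/
def eA (k : ℂ) (j i : Fin l) (p q : Fin n) (m : ℤ) : UA n l k := evA n l k (eB n l j i p q) m

/-- `ψ_{ji}[m] ⊗ e_{pq} = e_{ji} t^{m-1} ⊗ e_{pq}`; it is `0` unless `j > i`. -/
def psiA (k : ℂ) (j i : Fin l) (p q : Fin n) (m : ℤ) : UA n l k :=
  odA n l k (eM n l j i p q) (m - 1)

/-- Let `E(z) = ∑ₛ x[s] z^{-s-1}` and `Ψ(z) = ∑ₛ ψ[s] z^{-s}` be the fields of `x[-1]|0⟩`,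
`ψ[0]|0⟩`.  This is the coefficient of `z^{-m-1}` in the field `:E(z)Ψ(z):` of the
`(-1)`-product of these two vectors, applied to `v`.  The sum has finitely many nonzero terms. -/
def modeEPsi {k : ℂ} (x ψ : ℤ → UA n l k) (m : ℤ) (v : Va n l k) : Va n l k :=
  ∑ᶠ s : ℤ, if s < 0 then x s • ψ (m - s) • v else ψ (m - s) • x s • v

/-- The coefficient of `z^{-m-1}` in `:Ψ(z)E(z):`, the field of the `(-1)`-product of
`ψ[0]|0⟩` and `x[-1]|0⟩`, applied to `v`. -/
def modePsiE {k : ℂ} (ψ x : ℤ → UA n l k) (m : ℤ) (v : Va n l k) : Va n l k :=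
  ∑ᶠ s : ℤ, if s ≤ 0 then ψ s • x (m - s) • v else x (m - s) • ψ s • v

/-- `α = k + n (l - 1)`. -/
def alpha (k : ℂ) : ℂ := k + n * ((l : ℂ) - 1)

/-- The operator `[Q, e_{ji}[m] ⊗ e_{pq}]` on `V^k(a)`, for `j ≥ i`: the coefficient of
`z^{-m-1}` in the field of the vector
`∑_{a=i}^{j-1} ∑_r (e_{ai}[-1] ⊗ e_{rq}) (ψ_{ja}[0] ⊗ e_{pr})
  - ∑_{a=i+1}^{j} ∑_r (ψ_{ai}[0] ⊗ e_{rq}) (e_{ja}[-1] ⊗ e_{pr})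
  + α ψ_{ji}[-1] ⊗ e_{pq} + ψ_{j+1,i}[0] ⊗ e_{pq} - ψ_{j,i-1}[0] ⊗ e_{pq}`,
where the products are `(-1)`-products, `ψ` with indices out of range is `0`, and the field of
`ψ[-1]|0⟩` is the derivative of the field of `ψ[0]|0⟩`. -/
def brstMode (k : ℂ) (j i : Fin l) (p q : Fin n) (m : ℤ) (v : Va n l k) : Va n l k :=
  (∑ a ∈ Finset.Ico i j, ∑ r : Fin n, modeEPsi n l (eA n l k a i r q) (psiA n l k j a p r) m v)
  - (∑ a ∈ Finset.Ioc i j, ∑ r : Fin n, modePsiE n l (psiA n l k a i r q) (eA n l k j a p r) m v)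
  + (-(alpha n l k * (m : ℂ))) • (psiA n l k j i p q m • v)
  + (∑ a : Fin l, if (a : ℕ) = j + 1 then psiA n l k a i p q (m + 1) • v else 0)
  - (∑ a : Fin l, if (a : ℕ) + 1 = i then psiA n l k j a p q (m + 1) • v else 0)

/-- `QGraph v w` says that `Q v = w`, for the derivation `Q` and `v ∈ V^k(b)`.  The derivation
property and the compatibility with the translation operator say that `Q |0⟩ = 0` and that the
commutator of `Q` with a mode of the field of `u = e_{ji}[-1] ⊗ e_{pq}` is the same mode of the
field of `Q u`; this determines `Q` on all of `V^k(b)`. -/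
inductive QGraph (k : ℂ) : Vb n l k → Va n l k → Prop
  | vac : QGraph k (VAff.vac _) 0
  | add {v v' : Vb n l k} {w w' : Va n l k} : QGraph k v w → QGraph k v' w' →
      QGraph k (v + v') (w + w')
  | smul (c : ℂ) {v : Vb n l k} {w : Va n l k} : QGraph k v w → QGraph k (c • v) (c • w)
  | mode (j i : Fin l) (hij : i ≤ j) (p q : Fin n) (m : ℤ) {v : Vb n l k} {w : Va n l k} :
      QGraph k v w → QGraph k (AffAlg.mode (formB n l k) (eB n l j i p q) m • v)
        (brstMode n l k j i p q m (VbToVa n l k v) + eA n l k j i p q m • w)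

/-- The `W`-algebra `W^k(g, f) = {v ∈ V^k(b) | Q v = 0}`, as a subspace of `V^k(b)`. -/
def W (k : ℂ) : Submodule ℂ (Vb n l k) where
  carrier := {v | QGraph n l k v 0}
  add_mem' hv hw := by simpa using QGraph.add hv hw
  zero_mem' := by simpa using QGraph.smul 0 (QGraph.vac (n := n) (l := l) (k := k))
  smul_mem' c _ hv := by simpa using QGraph.smul c hv

/-- The Miura transformation `W^k(g, f) → V^k(l)`. -/
def miura (k : ℂ) : W n l k →ₗ[ℂ] Vl n l k := nu n l k ∘ₗ (W n l k).subtype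

/-! ## The matrix `B`, its column-determinant and the generators -/

/-- `gl_{l,≤0}`: the span of the `e_{ji}` with `j ≥ i`. -/
def glLe : Submodule ℂ (Matrix (Fin l) (Fin l) ℂ) where
  carrier := {x | ∀ a c, a < c → x a c = 0}
  add_mem' hx hy a c h := by simp [hx a c h, hy a c h]
  zero_mem' _ _ _ := rfl
  smul_mem' r _ hx a c h := by simp [hx a c h]

/-- The vector space `gl_{l,≤0}[t⁻¹]t⁻¹`; `Finsupp.single s x` is `x[-s-1]`. -/
abbrev NegLoop : Type := ℕ →₀ glLe l

/-- The tensor algebra `T(gl_{l,≤0}[t⁻¹]t⁻¹)`. -/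
abbrev TAlg : Type := TensorAlgebra ℂ (NegLoop l)

/-- The linear map `x[-s-1] ↦ (s + 1) x[-s-2]`. -/
def shift : NegLoop l →ₗ[ℂ] NegLoop l :=
  Finsupp.lsum ℂ fun s => ((s : ℂ) + 1) • Finsupp.lsingle (s + 1)

/-- `u ↦ u + ε D(u)`, where `D` is the derivation of the tensor algebra with
`D(x[-m]) = β m x[-m-1]`. -/
def dualHom (β : ℂ) : TAlg l →ₐ[ℂ] TrivSqZeroExt (TAlg l) (TAlg l) :=
  TensorAlgebra.lift ℂ
    ((TrivSqZeroExt.inlAlgHom ℂ (TAlg l) (TAlg l)).toLinearMap ∘ₗ TensorAlgebra.ι ℂ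
      + (TrivSqZeroExt.inrHom (TAlg l) (TAlg l)).restrictScalars ℂ ∘ₗ TensorAlgebra.ι ℂ
        ∘ₗ (β • shift l))

lemma dualHom_fst (β : ℂ) (u : TAlg l) : (dualHom l β u).fst = u := by
  have h : (TrivSqZeroExt.fstHom ℂ (TAlg l) (TAlg l)).comp (dualHom l β) = AlgHom.id ℂ _ := by
    ext x
    simp [dualHom]
  exact DFunLike.congr_fun h u

/-- The derivation of the tensor algebra with `x[-m] ↦ β m x[-m-1]`. -/
def tauDer (β : ℂ) : Der (TAlg l) where
  toLin := (TrivSqZeroExt.sndHom (TAlg l) (TAlg l)).restrictScalars ℂ ∘ₗ (dualHom l β).toLinearMap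
  leibniz a b := by
    simp [dualHom_fst, add_comm]

lemma tauDer_ι (β : ℂ) (s : ℕ) (x : glLe l) :
    (tauDer l β).toLin (TensorAlgebra.ι ℂ (Finsupp.single s x))
      = (β * (s + 1)) • TensorAlgebra.ι ℂ (Finsupp.single (s + 1) x) := by
  have h : Finsupp.single (s + 1) (β • ((s : ℂ) + 1) • x)
      = (β * (s + 1)) • (Finsupp.single (s + 1) x : NegLoop l) := by
    rw [Finsupp.smul_single, mul_smul]
  rw [← map_smul, ← h]
  simp [tauDer, dualHom, shift]

/-- The algebra `T(gl_{l,≤0}[t⁻¹]t⁻¹) ⊗ ℂ[τ]` with `[τ, x[-m]] = β m x[-m-1]`.  For `β = 1` this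
is `τ = -d/dt`; for `β = α` the generator plays the role of the product `α τ`. -/
abbrev TauAlg (β : ℂ) : Type _ := Ore (TAlg l) (tauDer l β)

/-- The element `e_{ji}[-1]`, for `j ≥ i` (and `0` for `j < i`). -/
def eT (j i : Fin l) : TAlg l :=
  if h : i ≤ j then TensorAlgebra.ι ℂ (Finsupp.single 0 ⟨Matrix.single j i 1, by
    intro a c hac
    rw [Matrix.single_apply, if_neg]
    rintro ⟨rfl, rfl⟩
    exact absurd h (not_le.mpr hac)⟩)
  else 0

/-- The matrix `B`, with `c τ + e_{aa}[-1]` on the diagonal, `e_{ab}[-1]` below the diagonal,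
`-1` on the first superdiagonal and `0` above it. -/
def Bmat (β c : ℂ) : Matrix (Fin l) (Fin l) (TauAlg l β) :=
  Matrix.of fun a b =>
    if a = b then c • Ore.tau _ + Ore.of _ (eT l a a)
    else if b < a then Ore.of _ (eT l a b)
    else if (b : ℕ) = a + 1 then -1
    else 0

/-- The column-determinant `∑_σ sgn σ · a_{σ(1)1} a_{σ(2)2} ⋯ a_{σ(l)l}`. -/
def cdet {R : Type*} [Ring R] (A : Matrix (Fin l) (Fin l) R) : R :=
  ∑ σ : Equiv.Perm (Fin l), ((Equiv.Perm.sign σ : ℤˣ) : ℤ) • (List.ofFn fun b => A (σ b) b).prod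

/-- The product `(c τ + e_{11}[-1]) ⋯ (c τ + e_{ll}[-1])`. -/
def diagProd (β c : ℂ) : TauAlg l β :=
  (List.ofFn fun a : Fin l => c • Ore.tau (tauDer l β) + Ore.of _ (eT l a a)).prod

/-- The element `x ⊗ e_{pq}` of `b = gl_{l,≤0} ⊗ gl_n`, as a Kronecker product; linear in `x`. -/
def kron (p q : Fin n) : glLe l →ₗ[ℂ] bAlg n l where
  toFun x := ⟨Matrix.kronecker (x : Matrix (Fin l) (Fin l) ℂ) (Matrix.single p q 1), by
    intro a c hac
    simp [Matrix.kroneckerMap_apply, x.2 a.1 c.1 hac]⟩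
  map_add' x y := Subtype.ext (Matrix.add_kronecker _ _ _)
  map_smul' r x := Subtype.ext (Matrix.smul_kronecker _ _ _)

/-- The homomorphism `T : T(gl_{l,≤0}[t⁻¹]t⁻¹) → M_n ⊗ U(b[t⁻¹]t⁻¹)` with
`T_{ij}(x) = x ⊗ e_{ji}` for `x ∈ gl_{l,≤0}[t⁻¹]t⁻¹`. -/
def calT : TAlg l →ₐ[ℂ] Matrix (Fin n) (Fin n) (UNeg (bAlg n l)) :=
  TensorAlgebra.lift ℂ (Finsupp.lsum ℂ fun s =>
    { toFun := fun x => Matrix.of fun i j => UNeg.gen (kron n l j i x) s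
      map_add' := fun x y => by ext i j; simp [UNeg.gen_add]
      map_smul' := fun r x => by ext i j; simp [UNeg.gen_smul] })

/-- The extension `T_{ij}(u S) = T_{ij}(u) S`, `S ∈ ℂ[τ]`, with values in the vector space
`U(b[t⁻¹]t⁻¹) ⊗ ℂ[τ]`. -/
def calTtau {β : ℂ} (i j : Fin n) (P : TauAlg l β) : UNeg (bAlg n l) ⊗[ℂ] Polynomial ℂ :=
  Polynomial.sum (P : Polynomial (TAlg l)) fun s u => (calT n l u i j) ⊗ₜ[ℂ] (Polynomial.X ^ s)

/-- The coefficient `W_{ij}^{(r)} ∈ U(b[t⁻¹]t⁻¹)` of `(α τ)^{l-r}` in `T_{ij}(cdet B)`.  So that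
`α = 0` is allowed, `α τ` is treated as a variable, which satisfies
`[α τ, x[-m]] = α m x[-m-1]`. -/
def genW (k : ℂ) (i j : Fin n) (r : Fin (l + 1)) : UNeg (bAlg n l) :=
  calT n l (Ore.coeff (l - r) (cdet l (Bmat l (alpha n l k) 1))) i j

/-- `W_{ij}^{(r)}` as an element of `V^k(b)`. -/
def genWvec (k : ℂ) (i j : Fin n) (r : Fin (l + 1)) : Vb n l k :=
  UNeg.toVac (formB n l k) (genW n l k i j r)

end Rect

end RectW

end

/-!
The column-determinant of the lower Hessenberg matrix `B` is computed by the recursion of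
noncommutative continuants: if `D_i` is the column-determinant of the corner of `B` with rows and
columns `≥ i`, then `D_i = ∑_{j ≥ i} B_{ji} D_{j+1}` (`exists_hessenberg_recursion`).  Everything
is deduced from this recursion for the coefficients of the powers of `α τ` (`CoeffRecursion`).

The membership in the `W`-algebra is the case of the first corner of the formula
`Q D_{b+1} = -∑_{c > b} ψ_{cb}[0] D_{c+1}`, where products of matrices over `gl_n` are understood
(`CornerRecursion.qGraph`).  It follows by descending induction on the corner.  In `D_i` the entry
`B_{ji}` stands to the left of `D_{j+1}`, which only involves the diagonal blocks after the `j`-th.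
On vectors built from these blocks the infinite sums in `[Q, e_{ji}[-1]]` reduce to their creation
parts (`brstMode_neg_one`): a mode of nonnegative degree of an odd current, or of a traceless even
current, of the first `j` blocks annihilates them, and the trace parts, which arise from the term
`tr x tr y` of the Killing form, occur twice with opposite signs.  The variable `α τ` acts on
coefficients through the translation operator, with which `Q` commutes (`QGraph.trans`).  The
remaining terms cancel in pairs (`brst_cancellation`): `B_{ai} ψ_{ja}` against the term
`-ψ_{ja}` of `Q B_{j,a+1}`, the term `α ψ_{ji}[-1]` against the commutator of `α τ` and
`ψ_{ji}[0]`, and `ψ_{j+1,i}` against `-ψ_{ai} B_{ja}`, by the recursion itself.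

The projection `b → l` kills the entries of `B` below the diagonal, which turns the recursion into
that of the ordered product of the diagonal entries (`CoeffRecursion.diag`).  Replacing the variable
`α τ` by `α` times the variable `τ` multiplies the coefficient of degree `s` by `α ^ s`
(`CoeffRecursion.rescale`), which gives the two versions of each identity.
-/

open scoped TensorProduct

noncomputable section

namespace RectW

attribute [local instance] LieRing.ofAssociativeRing

/-! ### Derivations of algebras given by generators and relations -/

section Derivations

section Lift

variable {X : Type*} (R : FreeAlgebra ℂ X → FreeAlgebra ℂ X → Prop)

/-- The algebra homomorphism `u ↦ u + ε δ(u)` from the free algebra to the dual numbers over its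
quotient. -/
def dualLift (δ : X → RingQuot R) :
    FreeAlgebra ℂ X →ₐ[ℂ] TrivSqZeroExt (RingQuot R) (RingQuot R) :=
  FreeAlgebra.lift ℂ fun x =>
    TrivSqZeroExt.inl (RingQuot.mkAlgHom ℂ R (FreeAlgebra.ι ℂ x)) + TrivSqZeroExt.inr (δ x)

variable {R}

lemma dualLift_fst (δ : X → RingQuot R) (u : FreeAlgebra ℂ X) :
    (dualLift R δ u).fst = RingQuot.mkAlgHom ℂ R u := by
  have h : (TrivSqZeroExt.fstHom ℂ (RingQuot R) (RingQuot R)).comp (dualLift R δ)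
      = RingQuot.mkAlgHom ℂ R := by
    ext x
    simp [dualLift]
  exact DFunLike.congr_fun h u

lemma dualLift_snd_ι (δ : X → RingQuot R) (x : X) :
    (dualLift R δ (FreeAlgebra.ι ℂ x)).snd = δ x := by
  simp [dualLift]

/-- The factorization of `dualLift` through the quotient algebra. -/
def dualQuot (δ : X → RingQuot R)
    (h : ∀ ⦃a b⦄, R a b → (dualLift R δ a).snd = (dualLift R δ b).snd) :
    RingQuot R →ₐ[ℂ] TrivSqZeroExt (RingQuot R) (RingQuot R) :=
  RingQuot.liftAlgHom ℂ ⟨dualLift R δ, fun a b hab => TrivSqZeroExt.ext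
    (by rw [dualLift_fst, dualLift_fst]; exact RingQuot.mkAlgHom_rel ℂ hab) (h hab)⟩

lemma dualQuot_mk (δ : X → RingQuot R)
    (h : ∀ ⦃a b⦄, R a b → (dualLift R δ a).snd = (dualLift R δ b).snd) (u : FreeAlgebra ℂ X) :
    dualQuot δ h (RingQuot.mkAlgHom ℂ R u) = dualLift R δ u :=
  RingQuot.liftAlgHom_mkAlgHom_apply ℂ _ _ _

lemma dualQuot_fst (δ : X → RingQuot R)
    (h : ∀ ⦃a b⦄, R a b → (dualLift R δ a).snd = (dualLift R δ b).snd) (u : RingQuot R) :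
    (dualQuot δ h u).fst = u := by
  obtain ⟨u, rfl⟩ := RingQuot.mkAlgHom_surjective ℂ R u
  rw [dualQuot_mk, dualLift_fst]

/-- The derivation of an algebra given by generators and relations which takes prescribed values
`δ` on the generators, provided that `δ` respects the relations. -/
def derLift (δ : X → RingQuot R)
    (h : ∀ ⦃a b⦄, R a b → (dualLift R δ a).snd = (dualLift R δ b).snd) : Der (RingQuot R) where
  toLin := (TrivSqZeroExt.sndHom (RingQuot R) (RingQuot R)).restrictScalars ℂ ∘ₗ
    (dualQuot δ h).toLinearMap
  leibniz a b := by
    change (dualQuot δ h (a * b)).snd = (dualQuot δ h a).snd * b + a * (dualQuot δ h b).snd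
    rw [map_mul, TrivSqZeroExt.snd_mul, dualQuot_fst, dualQuot_fst, smul_eq_mul,
      MulOpposite.smul_eq_mul_unop, MulOpposite.unop_op, add_comm]

lemma derLift_mk (δ : X → RingQuot R)
    (h : ∀ ⦃a b⦄, R a b → (dualLift R δ a).snd = (dualLift R δ b).snd) (x : X) :
    (derLift δ h).toLin (RingQuot.mkAlgHom ℂ R (FreeAlgebra.ι ℂ x)) = δ x := by
  change (dualQuot δ h _).snd = δ x
  rw [dualQuot_mk, dualLift_snd_ι]

end Lift

namespace Der

variable {A : Type*} [Ring A] [Algebra ℂ A] (d : Der A)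

lemma map_one : d.toLin 1 = 0 := by
  simpa using d.leibniz 1 1

lemma mem_span (S : Set A) (h : ∀ u ∈ S, d.toLin u ∈ Submodule.span A S) :
    ∀ u ∈ Submodule.span A S, d.toLin u ∈ Submodule.span A S := by
  intro u hu
  induction hu using Submodule.span_induction with
  | mem x hx => exact h x hx
  | zero => simp
  | add x y _ _ hx hy => rw [map_add]; exact Submodule.add_mem _ hx hy
  | smul a x hx' hx =>
    rw [smul_eq_mul, d.leibniz]
    exact Submodule.add_mem _ (Submodule.smul_mem _ _ hx') (Submodule.smul_mem _ _ hx)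

/-- The endomorphism of `A / I` induced by a derivation of `A` which preserves the left
ideal `I`. -/
def quot (I : Submodule A A) (h : ∀ u ∈ I, d.toLin u ∈ I) : LQuot I →ₗ[ℂ] LQuot I :=
  let F : LQuot I →+ LQuot I := QuotientAddGroup.map I.toAddSubgroup I.toAddSubgroup
    d.toLin.toAddMonoidHom (fun u hu => h u hu)
  have hF : ∀ u, F (LQuot.mk I u) = LQuot.mk I (d.toLin u) := fun _ => rfl
  { toFun := F
    map_add' := F.map_add
    map_smul' := by
      intro c v
      obtain ⟨u, rfl⟩ := LQuot.mk_surjective v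
      have h1 : ∀ u, c • LQuot.mk I u = LQuot.mk I (c • u) := fun u => by
        rw [Algebra.smul_def, ← smul_eq_mul, map_smul]; rfl
      rw [h1, hF, map_smul, RingHom.id_apply, hF, h1] }

lemma quot_mk (I : Submodule A A) (h : ∀ u ∈ I, d.toLin u ∈ I) (u : A) :
    d.quot I h (LQuot.mk I u) = LQuot.mk I (d.toLin u) := rfl

lemma quot_smul (I : Submodule A A) (h : ∀ u ∈ I, d.toLin u ∈ I) (a : A) (v : LQuot I) :
    d.quot I h (a • v) = d.toLin a • v + a • d.quot I h v := by
  obtain ⟨u, rfl⟩ := LQuot.mk_surjective v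
  rw [← map_smul, quot_mk, quot_mk, smul_eq_mul, d.leibniz, map_add, ← smul_eq_mul,
    ← smul_eq_mul, map_smul, map_smul]

end Der

end Derivations

/-! ### Translation operators -/

section Translation

section Affine

variable {L : Type*} [LieRing L] [LieAlgebra ℂ L] (κ : LinearMap.BilinForm ℂ L)

/-- The derivation `-d/dt` of the affinization: `x[m] ↦ -m x[m-1]`. -/
def AffAlg.der : Der (AffAlg κ) :=
  derLift (fun g => (-(g.2 : ℂ)) • mode κ g.1 (g.2 - 1)) (by
    intro a b hab
    cases hab with
    | add x y m =>
      simp only [map_add, TrivSqZeroExt.snd_add, dualLift_snd_ι, mode_add, smul_add]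
    | smul c x m => simp [dualLift_snd_ι, mode_smul, smul_comm c]
    | comm x y m p =>
      have hx : ∀ (z : L) (r : ℤ), RingQuot.mkAlgHom ℂ (AffRel κ) (FreeAlgebra.ι ℂ (z, r))
        = mode κ z r := fun _ _ => rfl
      simp only [map_mul, map_add, AlgHom.commutes, TrivSqZeroExt.snd_mul, TrivSqZeroExt.snd_add,
        dualLift_snd_ι, dualLift_fst, hx, smul_eq_mul, MulOpposite.smul_eq_mul_unop,
        MulOpposite.unop_op, TrivSqZeroExt.algebraMap_eq_inl', TrivSqZeroExt.snd_inl,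
        mul_smul_comm, smul_mul_assoc]
      rw [mode_comm κ x y m (p - 1), mode_comm κ x y (m - 1) p]
      have h1 : m + (p - 1) = m + p - 1 := by ring
      have h2 : m - 1 + p = m + p - 1 := by ring
      rw [h1, h2]
      by_cases h : m + p - 1 = 0
      · have hp : (p : ℂ) = 1 - m := by
          have : p = 1 - m := by omega
          rw [this]; push_cast; ring
        simp only [if_pos h, Algebra.algebraMap_eq_smul_one, hp]
        push_cast
        rw [hp]
        module
      · simp only [if_neg h, map_zero]
        push_cast
        module)

lemma AffAlg.der_mode (x : L) (m : ℤ) :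
    (der κ).toLin (mode κ x m) = (-(m : ℂ)) • mode κ x (m - 1) :=
  derLift_mk _ _ _

lemma AffAlg.der_vacIdeal : ∀ u ∈ vacIdeal κ, (der κ).toLin u ∈ vacIdeal κ :=
  Der.mem_span _ _ (by
    rintro _ ⟨x, m, hm, rfl⟩
    rw [der_mode]
    rcases hm.eq_or_lt with rfl | hm
    · simp
    · rw [Algebra.smul_def]
      exact Submodule.smul_mem _ _ (Submodule.subset_span ⟨x, m - 1, by omega, rfl⟩))

/-- The translation operator of the universal affine vertex algebra. -/
def VAff.trans : VAff κ →ₗ[ℂ] VAff κ := (AffAlg.der κ).quot _ (AffAlg.der_vacIdeal κ)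

lemma VAff.trans_vac : trans κ (vac κ) = 0 := by
  rw [trans, vac, Der.quot_mk, Der.map_one, map_zero]

lemma VAff.trans_mode (x : L) (m : ℤ) (v : VAff κ) :
    trans κ (AffAlg.mode κ x m • v)
      = (-(m : ℂ)) • AffAlg.mode κ x (m - 1) • v + AffAlg.mode κ x m • trans κ v := by
  rw [trans, Der.quot_smul, AffAlg.der_mode, smul_assoc]

end Affine

variable {n l : ℕ} {k : ℂ}

section UARelations

lemma evA_add (x y : bAlg n l) (m : ℤ) :
    evA n l k (x + y) m = evA n l k x m + evA n l k y m := by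
  simpa [evA] using RingQuot.mkAlgHom_rel ℂ (RelA.ev_add (k := k) x y m)

lemma evA_smul (c : ℂ) (x : bAlg n l) (m : ℤ) :
    evA n l k (c • x) m = c • evA n l k x m := by
  simpa [evA] using RingQuot.mkAlgHom_rel ℂ (RelA.ev_smul (k := k) c x m)

lemma odA_add (x y : mAlg n l) (m : ℤ) :
    odA n l k (x + y) m = odA n l k x m + odA n l k y m := by
  simpa [odA] using RingQuot.mkAlgHom_rel ℂ (RelA.od_add (k := k) x y m)

lemma odA_smul (c : ℂ) (x : mAlg n l) (m : ℤ) :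
    odA n l k (c • x) m = c • odA n l k x m := by
  simpa [odA] using RingQuot.mkAlgHom_rel ℂ (RelA.od_smul (k := k) c x m)

lemma evA_evA (x y : bAlg n l) (m p : ℤ) :
    evA n l k x m * evA n l k y p = evA n l k y p * evA n l k x m + evA n l k ⁅x, y⁆ (m + p)
      + algebraMap ℂ _ (if m + p = 0 then (m : ℂ) * formB n l k x y else 0) := by
  simpa only [evA, map_mul, map_add, AlgHom.commutes] using
    RingQuot.mkAlgHom_rel ℂ (RelA.ev_ev (k := k) x y m p)

lemma evA_odA (x : bAlg n l) (y : mAlg n l) (m p : ℤ) :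
    evA n l k x m * odA n l k y p
      = odA n l k y p * evA n l k x m + odA n l k (adM x y) (m + p) := by
  simpa only [evA, odA, map_mul, map_add] using
    RingQuot.mkAlgHom_rel ℂ (RelA.ev_od (k := k) x y m p)

lemma odA_odA (x y : mAlg n l) (m p : ℤ) :
    odA n l k x m * odA n l k y p + odA n l k y p * odA n l k x m = 0 := by
  simpa only [odA, map_mul, map_add, map_zero] using
    RingQuot.mkAlgHom_rel ℂ (RelA.od_od (k := k) x y m p)

lemma odA_zero (m : ℤ) : odA n l k 0 m = 0 := by
  simpa using odA_smul (k := k) (0 : ℂ) (0 : mAlg n l) m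

lemma evA_zero (m : ℤ) : evA n l k 0 m = 0 := by
  simpa using evA_smul (k := k) (0 : ℂ) (0 : bAlg n l) m

end UARelations

/-- The values of `-d/dt` on the generators of the enveloping algebra of `a`. -/
def derAGen (k : ℂ) : GenA n l → UA n l k
  | .ev x m => (-(m : ℂ)) • evA n l k x (m - 1)
  | .od y m => (-(m : ℂ)) • odA n l k y (m - 1)

/-- The derivation `-d/dt` of the enveloping algebra of `a`. -/
def derA (n l : ℕ) (k : ℂ) : Der (UA n l k) :=
  derLift (derAGen k) (by
    intro a b hab
    have hx : ∀ (z : bAlg n l) (r : ℤ),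
      RingQuot.mkAlgHom ℂ (RelA n l k) (FreeAlgebra.ι ℂ (.ev z r)) = evA n l k z r :=
      fun _ _ => rfl
    have hy : ∀ (z : mAlg n l) (r : ℤ),
      RingQuot.mkAlgHom ℂ (RelA n l k) (FreeAlgebra.ι ℂ (.od z r)) = odA n l k z r :=
      fun _ _ => rfl
    cases hab with
    | ev_add x y m =>
      simp only [map_add, TrivSqZeroExt.snd_add, dualLift_snd_ι, derAGen, evA_add, smul_add]
    | ev_smul c x m => simp [dualLift_snd_ι, derAGen, evA_smul, smul_comm c]
    | od_add x y m =>
      simp only [map_add, TrivSqZeroExt.snd_add, dualLift_snd_ι, derAGen, odA_add, smul_add]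
    | od_smul c x m => simp [dualLift_snd_ι, derAGen, odA_smul, smul_comm c]
    | ev_ev x y m p =>
      simp only [map_mul, map_add, AlgHom.commutes, TrivSqZeroExt.snd_mul, TrivSqZeroExt.snd_add,
        dualLift_snd_ι, dualLift_fst, hx, smul_eq_mul, MulOpposite.smul_eq_mul_unop,
        MulOpposite.unop_op, TrivSqZeroExt.algebraMap_eq_inl', TrivSqZeroExt.snd_inl,
        mul_smul_comm, smul_mul_assoc, derAGen]
      rw [evA_evA x y m (p - 1), evA_evA x y (m - 1) p]
      have h1 : m + (p - 1) = m + p - 1 := by ring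
      have h2 : m - 1 + p = m + p - 1 := by ring
      rw [h1, h2]
      by_cases h : m + p - 1 = 0
      · have hp : (p : ℂ) = 1 - m := by
          have : p = 1 - m := by omega
          rw [this]; push_cast; ring
        simp only [if_pos h, Algebra.algebraMap_eq_smul_one, hp]
        push_cast
        rw [hp]
        module
      · simp only [if_neg h, map_zero]
        push_cast
        module
    | ev_od x y m p =>
      simp only [map_mul, map_add, TrivSqZeroExt.snd_mul, TrivSqZeroExt.snd_add,
        dualLift_snd_ι, dualLift_fst, hx, hy, smul_eq_mul, MulOpposite.smul_eq_mul_unop,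
        MulOpposite.unop_op, mul_smul_comm, smul_mul_assoc, derAGen]
      rw [evA_odA x y m (p - 1), evA_odA x y (m - 1) p]
      have h1 : m + (p - 1) = m + p - 1 := by ring
      have h2 : m - 1 + p = m + p - 1 := by ring
      rw [h1, h2]
      push_cast
      module
    | od_od x y m p =>
      simp only [map_mul, map_add, map_zero, TrivSqZeroExt.snd_mul, TrivSqZeroExt.snd_add,
        dualLift_snd_ι, dualLift_fst, hy, smul_eq_mul, MulOpposite.smul_eq_mul_unop,
        MulOpposite.unop_op, TrivSqZeroExt.snd_zero, mul_smul_comm, smul_mul_assoc, derAGen]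
      rw [eq_neg_of_add_eq_zero_left (odA_odA x y m (p - 1)),
        eq_neg_of_add_eq_zero_left (odA_odA x y (m - 1) p)]
      module)

lemma derA_evA (x : bAlg n l) (m : ℤ) :
    (derA n l k).toLin (evA n l k x m) = (-(m : ℂ)) • evA n l k x (m - 1) :=
  derLift_mk _ _ _

lemma derA_odA (y : mAlg n l) (m : ℤ) :
    (derA n l k).toLin (odA n l k y m) = (-(m : ℂ)) • odA n l k y (m - 1) :=
  derLift_mk _ _ _

lemma derA_vacIdeal : ∀ u ∈ vacIdealA n l k, (derA n l k).toLin u ∈ vacIdealA n l k :=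
  Der.mem_span _ _ (by
    rintro _ (⟨x, m, hm, rfl⟩ | ⟨x, m, hm, rfl⟩)
    · rw [derA_evA]
      rcases hm.eq_or_lt with rfl | hm
      · simp
      · rw [Algebra.smul_def]
        exact Submodule.smul_mem _ _ (Submodule.subset_span (Or.inl ⟨x, m - 1, by omega, rfl⟩))
    · rw [derA_odA]
      rcases hm.eq_or_lt with rfl | hm
      · simp
      · rw [Algebra.smul_def]
        exact Submodule.smul_mem _ _ (Submodule.subset_span (Or.inr ⟨x, m - 1, by omega, rfl⟩)))

/-- The translation operator of `V^k(a)`. -/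
def transA (n l : ℕ) (k : ℂ) : Va n l k →ₗ[ℂ] Va n l k := (derA n l k).quot _ derA_vacIdeal

lemma transA_evA (x : bAlg n l) (m : ℤ) (v : Va n l k) :
    transA n l k (evA n l k x m • v)
      = (-(m : ℂ)) • evA n l k x (m - 1) • v + evA n l k x m • transA n l k v := by
  rw [transA, Der.quot_smul, derA_evA, smul_assoc]

lemma transA_odA (y : mAlg n l) (m : ℤ) (v : Va n l k) :
    transA n l k (odA n l k y m • v)
      = (-(m : ℂ)) • odA n l k y (m - 1) • v + odA n l k y m • transA n l k v := by
  rw [transA, Der.quot_smul, derA_odA, smul_assoc]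

lemma transA_vacA : transA n l k (vacA n l k) = 0 := by
  rw [transA, vacA, Der.quot_mk, Der.map_one, map_zero]

lemma VbToVa_vac : VbToVa n l k (VAff.vac _) = vacA n l k := by
  rw [VbToVa, VAff.vac, LQuot.map_mk, map_one]; rfl

lemma VbToVa_mode (x : bAlg n l) (m : ℤ) (v : Vb n l k) :
    VbToVa n l k (AffAlg.mode (formB n l k) x m • v) = evA n l k x m • VbToVa n l k v := by
  rw [VbToVa, LQuot.map_smul_alg, affToUA_mode]

/-- A property of vectors of a vacuum module holds for all of them if it holds for the vacuum
vector, and is stable under linear combinations and modes. -/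
lemma VAff.induction {L : Type*} [LieRing L] [LieAlgebra ℂ L] {κ : LinearMap.BilinForm ℂ L}
    {P : VAff κ → Prop} (vac : P (VAff.vac κ)) (add : ∀ v w, P v → P w → P (v + w))
    (smul : ∀ (c : ℂ) v, P v → P (c • v))
    (mode : ∀ x m v, P v → P (AffAlg.mode κ x m • v)) (v : VAff κ) : P v := by
  obtain ⟨u, rfl⟩ := LQuot.mk_surjective v
  obtain ⟨u, rfl⟩ := RingQuot.mkAlgHom_surjective ℂ (AffRel κ) u
  suffices h : ∀ w, P w → P (RingQuot.mkAlgHom ℂ (AffRel κ) u • w) by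
    have := h _ vac
    rwa [VAff.vac, ← map_smul, smul_eq_mul, mul_one] at this
  induction u using FreeAlgebra.induction with
  | grade0 r =>
    intro w hw
    rw [AlgHom.commutes]
    exact smul r w hw
  | grade1 g => exact fun w hw => mode g.1 g.2 w hw
  | mul a b ha hb =>
    intro w hw
    rw [map_mul, mul_smul]
    exact ha _ (hb _ hw)
  | add a b ha hb =>
    intro w hw
    rw [map_add, add_smul]
    exact add _ _ (ha _ hw) (hb _ hw)

lemma VbToVa_trans (v : Vb n l k) :
    VbToVa n l k (VAff.trans _ v) = transA n l k (VbToVa n l k v) := by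
  induction v using VAff.induction with
  | vac => rw [VAff.trans_vac, VbToVa_vac, transA_vacA, map_zero]
  | add v w hv hw => simp only [map_add, hv, hw]
  | smul c v hv => simp only [map_smul, hv]
  | mode x m v hv =>
    rw [VAff.trans_mode, map_add, map_smul, VbToVa_mode, VbToVa_mode, VbToVa_mode, transA_evA, hv]

end Translation

/-! ### Fields, normally ordered products and the differential -/

section Fields

variable {n l : ℕ} {k : ℂ}

lemma Va_algebraMap_smul (c : ℂ) (v : Va n l k) :
    algebraMap ℂ (UA n l k) c • v = c • v := rfl

lemma Va_smul_comm (a : UA n l k) (c : ℂ) (v : Va n l k) : a • c • v = c • a • v := by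
  rw [← Va_algebraMap_smul, ← Va_algebraMap_smul, ← mul_smul, ← mul_smul,
    Algebra.commutes c a]

/-- A property of vectors of `V^k(a)` holds for all of them if it holds for the vacuum vector, and
is stable under linear combinations and modes. -/
lemma Va_induction {P : Va n l k → Prop} (vac : P (vacA n l k))
    (add : ∀ v w, P v → P w → P (v + w)) (smul : ∀ (c : ℂ) v, P v → P (c • v))
    (ev : ∀ x m v, P v → P (evA n l k x m • v)) (od : ∀ y m v, P v → P (odA n l k y m • v))
    (v : Va n l k) : P v := by
  obtain ⟨u, rfl⟩ := LQuot.mk_surjective v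
  obtain ⟨u, rfl⟩ := RingQuot.mkAlgHom_surjective ℂ (RelA n l k) u
  suffices h : ∀ w, P w → P (RingQuot.mkAlgHom ℂ (RelA n l k) u • w) by
    have := h _ vac
    rwa [vacA, ← map_smul, smul_eq_mul, mul_one] at this
  induction u using FreeAlgebra.induction with
  | grade0 r =>
    intro w hw
    rw [AlgHom.commutes]
    exact smul r w hw
  | grade1 g =>
    cases g with
    | ev x m => exact fun w hw => ev x m w hw
    | od y m => exact fun w hw => od y m w hw
  | mul a b ha hb =>
    intro w hw
    rw [map_mul, mul_smul]
    exact ha _ (hb _ hw)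
  | add a b ha hb =>
    intro w hw
    rw [map_add, add_smul]
    exact add _ _ (ha _ hw) (hb _ hw)

lemma evA_vacA (x : bAlg n l) {m : ℤ} (hm : 0 ≤ m) : evA n l k x m • vacA n l k = 0 := by
  rw [vacA, ← map_smul, smul_eq_mul, mul_one, LQuot.mk_eq_zero]
  exact Submodule.subset_span (Or.inl ⟨x, m, hm, rfl⟩)

lemma odA_vacA (y : mAlg n l) {m : ℤ} (hm : 0 ≤ m) : odA n l k y m • vacA n l k = 0 := by
  rw [vacA, ← map_smul, smul_eq_mul, mul_one, LQuot.mk_eq_zero]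
  exact Submodule.subset_span (Or.inr ⟨y, m, hm, rfl⟩)

lemma evA_smul_evA_smul (x y : bAlg n l) (m p : ℤ) (v : Va n l k) :
    evA n l k x m • evA n l k y p • v = evA n l k y p • evA n l k x m • v
      + evA n l k ⁅x, y⁆ (m + p) • v
      + (if m + p = 0 then (m : ℂ) * formB n l k x y else 0) • v := by
  rw [← mul_smul, evA_evA, add_smul, add_smul, mul_smul, Va_algebraMap_smul]

lemma evA_smul_odA_smul (x : bAlg n l) (y : mAlg n l) (m p : ℤ) (v : Va n l k) :
    evA n l k x m • odA n l k y p • v = odA n l k y p • evA n l k x m • v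
      + odA n l k (adM x y) (m + p) • v := by
  rw [← mul_smul, evA_odA, add_smul, mul_smul]

lemma odA_smul_odA_smul (x y : mAlg n l) (m p : ℤ) (v : Va n l k) :
    odA n l k x m • odA n l k y p • v = -(odA n l k y p • odA n l k x m • v) := by
  rw [← mul_smul, eq_neg_of_add_eq_zero_left (odA_odA x y m p), neg_smul, mul_smul]

/-- Every vector of `V^k(a)` is annihilated by all modes of sufficiently high degree, so that the
sums which define normally ordered products are finite. -/
lemma exists_modes_vanish (v : Va n l k) :
    ∃ M : ℤ, ∀ s, M ≤ s → (∀ x, evA n l k x s • v = 0) ∧ ∀ y, odA n l k y s • v = 0 := by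
  induction v using Va_induction with
  | vac => exact ⟨0, fun s hs => ⟨fun x => evA_vacA x hs, fun y => odA_vacA y hs⟩⟩
  | add v w hv hw =>
    obtain ⟨M, hM⟩ := hv
    obtain ⟨M', hM'⟩ := hw
    refine ⟨max M M', fun s hs => ⟨fun x => ?_, fun y => ?_⟩⟩
    · rw [smul_add, (hM s (by omega)).1, (hM' s (by omega)).1, add_zero]
    · rw [smul_add, (hM s (by omega)).2, (hM' s (by omega)).2, add_zero]
  | smul c v hv =>
    obtain ⟨M, hM⟩ := hv
    refine ⟨M, fun s hs => ⟨fun x => ?_, fun y => ?_⟩⟩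
    · rw [Va_smul_comm, (hM s hs).1, smul_zero]
    · rw [Va_smul_comm, (hM s hs).2, smul_zero]
  | ev x m v hv =>
    obtain ⟨M, hM⟩ := hv
    refine ⟨max M (max (M - m) (1 - m)), fun s hs => ⟨fun y => ?_, fun y => ?_⟩⟩
    · rw [evA_smul_evA_smul, (hM s (by omega)).1, (hM (s + m) (by omega)).1,
        if_neg (by omega), zero_smul, smul_zero, add_zero, add_zero]
    · have h := evA_smul_odA_smul x y m s v
      rw [(hM s (by omega)).2, (hM (m + s) (by omega)).2, smul_zero, add_zero] at h
      exact h.symm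
  | od y m v hv =>
    obtain ⟨M, hM⟩ := hv
    refine ⟨max M (M - m), fun s hs => ⟨fun x => ?_, fun x => ?_⟩⟩
    · rw [evA_smul_odA_smul, (hM s (by omega)).1, (hM (s + m) (by omega)).2, smul_zero, add_zero]
    · rw [odA_smul_odA_smul, (hM s (by omega)).2, smul_zero, neg_zero]

/-- The family of modes `x[s]` behaves like the modes of a field: `∑ x[s] z^{t-s-1}` is smooth
on `V^k(a)`, and its commutator with the translation operator is its derivative. -/
structure IsField (t : ℤ) (x : ℤ → UA n l k) : Prop where
  trans : ∀ s v, transA n l k (x s • v)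
    = (-((s : ℂ) - t)) • x (s - 1) • v + x s • transA n l k v
  vanish : ∀ v : Va n l k, ∃ M : ℤ, ∀ s, M ≤ s → x s • v = 0

lemma isField_evA (x : bAlg n l) : IsField 0 (evA n l k x) where
  trans s v := by rw [transA_evA, Int.cast_zero, sub_zero]
  vanish v := (exists_modes_vanish v).imp fun _ h s hs => (h s hs).1 x

lemma isField_eA (j i : Fin l) (p q : Fin n) : IsField 0 (eA n l k j i p q) :=
  isField_evA _

lemma isField_psiA (j i : Fin l) (p q : Fin n) : IsField 1 (psiA n l k j i p q) where
  trans s v := by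
    rw [psiA, transA_odA, psiA]
    push_cast
    rfl
  vanish v := by
    obtain ⟨M, hM⟩ := exists_modes_vanish v
    exact ⟨M + 1, fun s hs => (hM (s - 1) (by omega)).2 _⟩

/-- The `m`-th mode of the normally ordered product of the fields with modes `a` and `b`; the
modes `a[s]` with `s < t` are the creation operators. -/
def normalOrd (t : ℤ) (a b : ℤ → UA n l k) (m : ℤ) (v : Va n l k) : Va n l k :=
  ∑ᶠ s : ℤ, if s < t then a s • b (m - s) • v else b (m - s) • a s • v

lemma modePsiE_eq (ψ x : ℤ → UA n l k) : modePsiE n l ψ x = normalOrd 1 ψ x := by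
  funext m v
  simp only [modePsiE, normalOrd, Int.lt_iff_add_one_le, add_le_iff_nonpos_left]

lemma normalOrd_support_finite {t t' : ℤ} {a b : ℤ → UA n l k} (ha : IsField t a)
    (hb : IsField t' b) (c m : ℤ) (v : Va n l k) :
    (Function.support fun s : ℤ =>
      if s < c then a s • b (m - s) • v else b (m - s) • a s • v).Finite := by
  obtain ⟨M, hM⟩ := ha.vanish v
  obtain ⟨M', hM'⟩ := hb.vanish v
  refine (Set.finite_Icc (min (m - M') c) (max M c)).subset fun s hs => ?_
  rw [Function.mem_support] at hs
  by_contra hs'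
  rw [Set.mem_Icc] at hs'
  apply hs
  split_ifs with h
  · rw [hM' (m - s) (by omega), smul_zero]
  · rw [hM s (by omega), smul_zero]

/-- Normally ordered products of fields are translation covariant. -/
lemma transA_normalOrd {t : ℤ} {a b : ℤ → UA n l k} (ha : IsField t a)
    (hb : IsField (1 - t) b) (m : ℤ) (v : Va n l k) :
    transA n l k (normalOrd t a b m v)
      = (-(m : ℂ)) • normalOrd t a b (m - 1) v + normalOrd t a b m (transA n l k v) := by
  set F : ℤ → Va n l k := fun s =>
    if s < t then a s • b (m - 1 - s) • v else b (m - 1 - s) • a s • v with hF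
  have hFfin : F.support.Finite := normalOrd_support_finite ha hb t (m - 1) v
  have hA : (Function.support fun s : ℤ => (-((s : ℂ) + 1 - t)) • F s).Finite :=
    hFfin.subset fun s hs hF0 => hs (by simp only [hF0, smul_zero])
  have hB : (Function.support fun s : ℤ => (-((m : ℂ) - s - (1 - t))) • F s).Finite :=
    hFfin.subset fun s hs hF0 => hs (by simp only [hF0, smul_zero])
  have hC := normalOrd_support_finite ha hb t m (transA n l k v)
  have hA' : (Function.support fun s : ℤ => (-((s : ℂ) - t)) • F (s - 1)).Finite := by
    refine (hA.image (Equiv.addRight (1 : ℤ))).subset fun s hs => ⟨s - 1, ?_, by simp⟩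
    simpa using hs
  have hterm : ∀ s : ℤ, transA n l k
      (if s < t then a s • b (m - s) • v else b (m - s) • a s • v)
      = (-((s : ℂ) - t)) • F (s - 1) + (-((m : ℂ) - s - (1 - t))) • F s
        + (if s < t then a s • b (m - s) • transA n l k v
            else b (m - s) • a s • transA n l k v) := by
    intro s
    have e1 : m - s - 1 = m - 1 - s := by ring
    have e2 : m - 1 - (s - 1) = m - s := by ring
    by_cases h : s < t
    · simp only [hF, if_pos h, if_pos (show s - 1 < t by omega), ha.trans, hb.trans, e1, e2,
        smul_add, Va_smul_comm]
      push_cast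
      abel
    · rcases (not_lt.mp h).eq_or_lt with h' | h'
      · -- the two orderings differ at the boundary, where the coefficient is zero
        subst h'
        simp only [hF, if_neg h, ha.trans, hb.trans, e1, smul_add, sub_self,
          neg_zero, zero_smul, smul_zero]
        push_cast
        abel
      · simp only [hF, if_neg h, if_neg (show ¬ s - 1 < t by omega), ha.trans, hb.trans, e1, e2,
          smul_add, Va_smul_comm]
        push_cast
        abel
  have hshift : ∑ᶠ s : ℤ, (-((s : ℂ) - t)) • F (s - 1)
      = ∑ᶠ s : ℤ, (-((s : ℂ) + 1 - t)) • F s := by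
    rw [← finsum_comp_equiv (Equiv.addRight (1 : ℤ))]
    simp
  have hAB : (Function.support fun s : ℤ =>
      (-((s : ℂ) - t)) • F (s - 1) + (-((m : ℂ) - s - (1 - t))) • F s).Finite :=
    (hA'.union hB).subset (Function.support_add _ _)
  rw [normalOrd, map_finsum (transA n l k) (normalOrd_support_finite ha hb t m v),
    finsum_congr hterm]
  rw [finsum_add_distrib hAB hC, finsum_add_distrib hA' hB, hshift, ← finsum_add_distrib hA hB]
  congr 1
  rw [normalOrd, smul_finsum' _ hFfin]
  refine finsum_congr fun s => ?_
  rw [← add_smul]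
  congr 1
  ring

lemma transA_modeEPsi {x ψ : ℤ → UA n l k} (hx : IsField 0 x) (hψ : IsField 1 ψ) (m : ℤ)
    (v : Va n l k) : transA n l k (modeEPsi n l x ψ m v)
      = (-(m : ℂ)) • modeEPsi n l x ψ (m - 1) v + modeEPsi n l x ψ m (transA n l k v) :=
  transA_normalOrd hx hψ m v

lemma transA_modePsiE {ψ x : ℤ → UA n l k} (hψ : IsField 1 ψ) (hx : IsField 0 x) (m : ℤ)
    (v : Va n l k) : transA n l k (modePsiE n l ψ x m v)
      = (-(m : ℂ)) • modePsiE n l ψ x (m - 1) v + modePsiE n l ψ x m (transA n l k v) := by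
  rw [modePsiE_eq]
  exact transA_normalOrd hψ hx m v

lemma transA_psiA (j i : Fin l) (p q : Fin n) (m : ℤ) (v : Va n l k) :
    transA n l k (psiA n l k j i p q m • v)
      = (-((m : ℂ) - 1)) • psiA n l k j i p q (m - 1) • v
        + psiA n l k j i p q m • transA n l k v := by
  simpa using (isField_psiA j i p q).trans m v

lemma transA_brstMode (j i : Fin l) (p q : Fin n) (m : ℤ) (v : Va n l k) :
    transA n l k (brstMode n l k j i p q m v)
      = (-(m : ℂ)) • brstMode n l k j i p q (m - 1) v
        + brstMode n l k j i p q m (transA n l k v) := by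
  have hite : ∀ (P : Prop) [Decidable P] (j i : Fin l),
      transA n l k (if P then psiA n l k j i p q (m + 1) • v else 0)
        = (-(m : ℂ)) • (if P then psiA n l k j i p q (m - 1 + 1) • v else 0)
          + (if P then psiA n l k j i p q (m + 1) • transA n l k v else 0) := by
    intro P _ j i
    split_ifs
    · rw [transA_psiA]
      push_cast
      simp
    · simp
  have hα : (-(alpha n l k * (m : ℂ))) • transA n l k (psiA n l k j i p q m • v)
      = (-(m : ℂ)) • (-(alpha n l k * ((m - 1 : ℤ) : ℂ))) • psiA n l k j i p q (m - 1) • v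
        + (-(alpha n l k * (m : ℂ))) • psiA n l k j i p q m • transA n l k v := by
    simp only [transA_psiA, smul_add, smul_smul]
    congr 2
    push_cast
    ring
  simp only [brstMode, map_add, map_sub, map_sum, map_smul, hite, hα,
    transA_modeEPsi (isField_eA _ _ _ _) (isField_psiA _ _ _ _),
    transA_modePsiE (isField_psiA _ _ _ _) (isField_eA _ _ _ _),
    Finset.sum_add_distrib, ← Finset.smul_sum, smul_add, smul_sub]
  abel

/-- The differential commutes with the translation operators. -/
lemma QGraph.trans {v : Vb n l k} {w : Va n l k} (h : QGraph n l k v w) :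
    QGraph n l k (VAff.trans _ v) (transA n l k w) := by
  induction h with
  | vac => simpa [VAff.trans_vac] using QGraph.smul 0 (QGraph.vac (n := n) (l := l) (k := k))
  | add _ _ h1 h2 => simpa only [map_add] using QGraph.add h1 h2
  | smul c _ h => simpa only [map_smul] using QGraph.smul c h
  | mode j i hij p q m h ih =>
    rename_i v w
    have h1 := QGraph.add (QGraph.smul (-(m : ℂ)) (QGraph.mode j i hij p q (m - 1) h))
      (QGraph.mode j i hij p q m ih)
    rw [← VAff.trans_mode, VbToVa_trans] at h1
    convert h1 using 1
    rw [map_add, transA_brstMode, eA, transA_evA, smul_add]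
    simp only [eA]
    abel

end Fields

/-! ### Contractions between diagonal blocks -/

section Blocks

variable {n l : ℕ} {k : ℂ}

/-- The matrix is supported in the diagonal blocks of index less than `i`. -/
def LowSupp (i : ℕ) (x : Gl n l) : Prop :=
  ∀ a c, x a c ≠ 0 → (a.1 : ℕ) < i ∧ (c.1 : ℕ) < i

/-- The matrix is supported in the diagonal blocks of index at least `i`. -/
def HighSupp (i : ℕ) (x : Gl n l) : Prop :=
  ∀ a c, x a c ≠ 0 → i ≤ (a.1 : ℕ) ∧ i ≤ (c.1 : ℕ)

lemma LowSupp.mul_high {i : ℕ} {x y : Gl n l} (hx : LowSupp i x) (hy : HighSupp i y) :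
    x * y = 0 := by
  ext a c
  rw [Matrix.mul_apply, Matrix.zero_apply]
  refine Finset.sum_eq_zero fun d _ => ?_
  by_contra h
  have h1 := hx a d (left_ne_zero_of_mul h)
  have h2 := hy d c (right_ne_zero_of_mul h)
  omega

lemma HighSupp.mul_low {i : ℕ} {x y : Gl n l} (hx : LowSupp i x) (hy : HighSupp i y) :
    y * x = 0 := by
  ext a c
  rw [Matrix.mul_apply, Matrix.zero_apply]
  refine Finset.sum_eq_zero fun d _ => ?_
  by_contra h
  have h1 := hy a d (left_ne_zero_of_mul h)
  have h2 := hx d c (right_ne_zero_of_mul h)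
  omega

lemma LowSupp.lie_high {i : ℕ} {x y : Gl n l} (hx : LowSupp i x) (hy : HighSupp i y) :
    ⁅x, y⁆ = 0 := by
  rw [Ring.lie_def, hx.mul_high hy, HighSupp.mul_low hx hy, sub_zero]

/-- Currents supported in complementary diagonal blocks are orthogonal up to the trace part of the
Killing form. -/
lemma kappaB_low_high {i : ℕ} {x y : Gl n l} (hx : LowSupp i x) (htr : x.trace = 0)
    (hy : HighSupp i y) : kappaB n l k x y = 0 := by
  have h1 := hx.mul_high hy
  have h2 := HighSupp.mul_low hx hy
  have htr' : ∑ a, x a a = 0 := htr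
  have hK : killingForm ℂ (Gl n l) x y = 0 := by
    rw [killingForm_apply_apply, trace_eq]
    simp only [LinearMap.comp_apply, ad_ad_single, h1, h2, Matrix.zero_apply, zero_sub, add_zero,
      Finset.sum_sub_distrib, Finset.sum_neg_distrib, ← Finset.mul_sum, ← Finset.sum_mul, htr',
      zero_mul, mul_zero, neg_zero, Finset.sum_const_zero]
  have hT : traceG0 n l x y = 0 := by
    rw [traceG0, LinearMap.mk₂_apply, trace_eq]
    refine Finset.sum_eq_zero fun a _ => Finset.sum_eq_zero fun c _ => ?_
    rw [LinearMap.comp_apply, LinearMap.comp_apply, p0_apply]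
    split_ifs with hac
    · rw [ad_ad_single, h1, h2]
      have e : ∀ a c : Idx n l, a.1 = c.1 → x a a * y c c = 0 := by
        intro a c hac
        by_contra h
        have h3 := hx a a (left_ne_zero_of_mul h)
        have h4 := hy c c (right_ne_zero_of_mul h)
        rw [hac] at h3
        omega
      rw [e a c hac, mul_comm (y a a), e c a hac.symm]
      simp
    · rfl
  simp only [kappaB, kappa, LinearMap.add_apply, LinearMap.sub_apply, LinearMap.smul_apply, hK, hT,
    smul_zero, add_zero, sub_zero]

/-- The vectors of `V^k(a)` annihilated by the modes of nonnegative degree of all odd currents and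
all traceless even currents supported in the diagonal blocks of index less than `i`. -/
def blockVacuum (n l : ℕ) (k : ℂ) (i : ℕ) : Submodule ℂ (Va n l k) where
  carrier := {v | (∀ x : bAlg n l, LowSupp i (x : Gl n l) → (x : Gl n l).trace = 0 →
      ∀ s, 0 ≤ s → evA n l k x s • v = 0) ∧
    ∀ y : mAlg n l, LowSupp i (y : Gl n l) → ∀ s, 0 ≤ s → odA n l k y s • v = 0}
  add_mem' hv hw :=
    ⟨fun x hx ht s hs => by rw [smul_add, hv.1 x hx ht s hs, hw.1 x hx ht s hs, add_zero],
      fun y hy s hs => by rw [smul_add, hv.2 y hy s hs, hw.2 y hy s hs, add_zero]⟩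
  zero_mem' := ⟨fun _ _ _ _ _ => smul_zero _, fun _ _ _ _ => smul_zero _⟩
  smul_mem' c v hv :=
    ⟨fun x hx ht s hs => by rw [Va_smul_comm, hv.1 x hx ht s hs, smul_zero],
      fun y hy s hs => by rw [Va_smul_comm, hv.2 y hy s hs, smul_zero]⟩

lemma vacA_mem_blockVacuum (i : ℕ) : vacA n l k ∈ blockVacuum n l k i :=
  ⟨fun x _ _ _ hs => evA_vacA x hs, fun y _ _ hs => odA_vacA y hs⟩

lemma blockVacuum_anti {i i' : ℕ} (h : i ≤ i') : blockVacuum n l k i' ≤ blockVacuum n l k i := by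
  have hL : ∀ x : Gl n l, LowSupp i x → LowSupp i' x := fun x hx a c hac =>
    ⟨(hx a c hac).1.trans_le h, (hx a c hac).2.trans_le h⟩
  exact fun v hv => ⟨fun x hx => hv.1 x (hL _ hx), fun y hy => hv.2 y (hL _ hy)⟩

lemma evA_smul_mem_blockVacuum {i : ℕ} {z : bAlg n l} (hz : HighSupp i (z : Gl n l)) (m : ℤ)
    {v : Va n l k} (hv : v ∈ blockVacuum n l k i) :
    evA n l k z m • v ∈ blockVacuum n l k i := by
  refine ⟨fun x hx ht s hs => ?_, fun y hy s hs => ?_⟩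
  · have h1 : ⁅x, z⁆ = 0 := Subtype.ext (hx.lie_high hz)
    have h2 : formB n l k x z = 0 := kappaB_low_high hx ht hz
    rw [evA_smul_evA_smul, hv.1 x hx ht s hs, h1, h2, evA_zero]
    simp
  · have h1 : adM z y = 0 := Subtype.ext (by
      change ⁅(z : Gl n l), (y : Gl n l)⁆ = 0
      rw [← lie_skew, hy.lie_high hz, neg_zero])
    have h := evA_smul_odA_smul (k := k) z y m s v
    rw [hv.2 y hy s hs, h1, odA_zero, smul_zero, zero_smul, add_zero] at h
    exact h.symm

lemma transA_mem_blockVacuum {i : ℕ} {v : Va n l k} (hv : v ∈ blockVacuum n l k i) :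
    transA n l k v ∈ blockVacuum n l k i := by
  refine ⟨fun x hx ht s hs => ?_, fun y hy s hs => ?_⟩
  · have h := transA_evA (k := k) x s v
    rw [hv.1 x hx ht s hs, map_zero] at h
    rcases hs.eq_or_lt with rfl | hs'
    · simpa using h.symm
    · rw [hv.1 x hx ht (s - 1) (by omega), smul_zero, zero_add] at h
      exact h.symm
  · have h := transA_odA (k := k) y s v
    rw [hv.2 y hy s hs, map_zero] at h
    rcases hs.eq_or_lt with rfl | hs'
    · simpa using h.symm
    · rw [hv.2 y hy (s - 1) (by omega), smul_zero, zero_add] at h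
      exact h.symm

lemma eB_coe {j i : Fin l} (h : i ≤ j) (p q : Fin n) :
    ((eB n l j i p q : bAlg n l) : Gl n l) = Matrix.single (j, p) (i, q) 1 := by
  rw [eB, dif_pos h]

lemma eB_highSupp {j i : Fin l} (h : i ≤ j) (p q : Fin n) :
    HighSupp i ((eB n l j i p q : bAlg n l) : Gl n l) := by
  intro a c hac
  rw [eB_coe h, Matrix.single_apply] at hac
  obtain ⟨rfl, rfl⟩ := (ite_ne_right_iff.mp hac).1
  exact ⟨h, le_rfl⟩

lemma single_lowSupp {j i b : Fin l} (hj : j ≤ b) (hi : i ≤ b) (p q : Fin n) :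
    LowSupp ((b : ℕ) + 1) (Matrix.single (j, p) (i, q) 1 : Gl n l) := by
  intro a c hac
  rw [Matrix.single_apply] at hac
  obtain ⟨rfl, rfl⟩ := (ite_ne_right_iff.mp hac).1
  exact ⟨Nat.lt_succ_of_le hj, Nat.lt_succ_of_le hi⟩

lemma trace_single_idx (j i : Fin l) (p q : Fin n) :
    (Matrix.single (j, p) (i, q) 1 : Gl n l).trace = if j = i ∧ p = q then 1 else 0 := by
  split_ifs with h
  · rw [h.1, h.2, Matrix.trace_single_eq_same]
  · exact Matrix.trace_single_eq_of_ne _ _ _ fun h' => h (Prod.mk.inj h')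

lemma psiA_smul_eq_zero {b j i : Fin l} (hj : j ≤ b) (p q : Fin n) {v : Va n l k}
    (hv : v ∈ blockVacuum n l k (b + 1)) {s : ℤ} (hs : 1 ≤ s) :
    psiA n l k j i p q s • v = 0 := by
  rw [psiA, eM]
  split_ifs with h
  · exact hv.2 _ (single_lowSupp hj (h.le.trans hj) p q) _ (by omega)
  · rw [odA_zero, zero_smul]

lemma eA_smul_eq_zero {b j i : Fin l} (hij : i ≤ j) (hj : j ≤ b) {p q : Fin n}
    (h : ¬ (j = i ∧ p = q)) {v : Va n l k} (hv : v ∈ blockVacuum n l k (b + 1)) {s : ℤ}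
    (hs : 0 ≤ s) : eA n l k j i p q s • v = 0 := by
  refine hv.1 _ ?_ ?_ s hs
  · rw [eB_coe hij]
    exact single_lowSupp hj (hij.trans hj) p q
  · rw [eB_coe hij, trace_single_idx, if_neg h]

lemma eA_diag_smul_eq {b i j : Fin l} (hi : i ≤ b) (hj : j ≤ b) (p q : Fin n) {v : Va n l k}
    (hv : v ∈ blockVacuum n l k (b + 1)) {s : ℤ} (hs : 0 ≤ s) :
    eA n l k i i p p s • v = eA n l k j j q q s • v := by
  have h := hv.1 (eB n l i i p p + (-1 : ℂ) • eB n l j j q q) (by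
    intro a c hac
    have hac' : (eB n l i i p p : Gl n l) a c ≠ 0 ∨ (eB n l j j q q : Gl n l) a c ≠ 0 := by
      by_contra hc
      push Not at hc
      apply hac
      change (eB n l i i p p : Gl n l) a c + (-1 : ℂ) * (eB n l j j q q : Gl n l) a c = 0
      rw [hc.1, hc.2, mul_zero, add_zero]
    rw [eB_coe le_rfl, eB_coe le_rfl] at hac'
    exact hac'.elim (single_lowSupp hi hi p p a c) (single_lowSupp hj hj q q a c)) (by
    change ((eB n l i i p p : Gl n l) + (-1 : ℂ) • (eB n l j j q q : Gl n l)).trace = 0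
    rw [eB_coe le_rfl, eB_coe le_rfl, Matrix.trace_add, Matrix.trace_smul, trace_single_idx,
      trace_single_idx]
    simp) s hs
  rw [evA_add, evA_smul, add_smul, smul_assoc, neg_one_smul, ← sub_eq_add_neg, sub_eq_zero] at h
  exact h

/-- The part of the normally ordered product of an odd and an even field which involves the
annihilation operators of the even one. -/
def annihPart (ψ x : ℤ → UA n l k) (v : Va n l k) : Va n l k :=
  ∑ᶠ s : ℤ, if 0 ≤ s then ψ (-1 - s) • x s • v else 0

lemma annihPart_congr {ψ x x' : ℤ → UA n l k} {v : Va n l k}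
    (h : ∀ s, 0 ≤ s → x s • v = x' s • v) : annihPart ψ x v = annihPart ψ x' v := by
  refine finsum_congr fun s => ?_
  split_ifs with hs
  · rw [h s hs]
  · rfl

lemma annihPart_eq_zero {ψ x : ℤ → UA n l k} {v : Va n l k}
    (h : ∀ s, 0 ≤ s → x s • v = 0) : annihPart ψ x v = 0 := by
  refine finsum_eq_zero_of_forall_eq_zero fun s => ?_
  split_ifs with hs
  · rw [h s hs, smul_zero]
  · rfl

lemma annihPart_support_finite {ψ x : ℤ → UA n l k} (hx : IsField 0 x) (v : Va n l k) :
    (Function.support fun s : ℤ => if 0 ≤ s then ψ (-1 - s) • x s • v else 0).Finite := by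
  obtain ⟨M, hM⟩ := hx.vanish v
  refine (Set.finite_Icc 0 M).subset fun s hs => ?_
  rw [Function.mem_support] at hs
  by_contra hs'
  rw [Set.mem_Icc] at hs'
  apply hs
  split_ifs with h
  · rw [hM s (by omega), smul_zero]
  · rfl

lemma finsum_single_add {f g : ℤ → Va n l k} (t : ℤ) (u : Va n l k)
    (hg : (Function.support g).Finite) (h : ∀ s, f s = (if s = t then u else 0) + g s) :
    ∑ᶠ s, f s = u + ∑ᶠ s, g s := by
  have h0 : (Function.support fun s : ℤ => if s = t then u else 0).Finite :=
    (Set.finite_singleton t).subset fun s hs => by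
      by_contra h
      exact hs (if_neg h)
  rw [finsum_congr h, finsum_add_distrib h0 hg]
  congr 1
  rw [finsum_eq_single _ t (fun s hs => if_neg hs), if_pos rfl]

lemma modeEPsi_neg_one {x ψ : ℤ → UA n l k} (hx : IsField 0 x) {v : Va n l k}
    (hψ : ∀ s, 1 ≤ s → ψ s • v = 0) :
    modeEPsi n l x ψ (-1) v = x (-1) • ψ 0 • v + annihPart ψ x v := by
  refine finsum_single_add (-1) _ (annihPart_support_finite hx v) fun s => ?_
  rcases lt_trichotomy s (-1) with h | rfl | h
  · rw [if_pos (by omega), if_neg (by omega), if_neg (by omega), hψ _ (by omega), smul_zero,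
      add_zero]
  · simp
  · rw [if_neg (by omega), if_neg (by omega), if_pos (by omega), zero_add]

lemma modePsiE_neg_one {ψ x : ℤ → UA n l k} (hx : IsField 0 x) {v : Va n l k}
    (hψ : ∀ s, 1 ≤ s → ψ s • v = 0) :
    modePsiE n l ψ x (-1) v = ψ 0 • x (-1) • v + annihPart ψ x v := by
  have hr : annihPart ψ x v
      = ∑ᶠ s : ℤ, if s ≤ -1 then ψ s • x (-1 - s) • v else 0 := by
    rw [annihPart, ← finsum_comp_equiv (Equiv.subLeft (-1 : ℤ))]
    refine finsum_congr fun s => ?_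
    simp only [Equiv.subLeft_apply, sub_sub_cancel]
    exact if_congr (by omega) rfl rfl
  have hfin : (Function.support fun s : ℤ =>
      if s ≤ -1 then ψ s • x (-1 - s) • v else 0).Finite := by
    refine ((annihPart_support_finite (ψ := ψ) hx v).image (Equiv.subLeft (-1 : ℤ))).subset
      fun s hs => ⟨-1 - s, ?_, by simp⟩
    rw [Function.mem_support] at hs ⊢
    rw [sub_sub_cancel]
    rwa [if_congr (show 0 ≤ -1 - s ↔ s ≤ -1 by omega) rfl rfl]
  rw [hr]
  refine finsum_single_add 0 _ hfin fun s => ?_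
  rcases lt_trichotomy s 0 with h | rfl | h
  · rw [if_pos h.le, if_neg h.ne, if_pos (by omega), zero_add]
  · simp
  · rw [if_neg (by omega), if_neg (by omega), if_neg (by omega), hψ _ (by omega), smul_zero,
      add_zero]

/-- On vectors built from the blocks following `j`, the operator `[Q, e_{ji}[-1] ⊗ e_{pq}]`
involves no contractions: those of `e_{ii}` and of `e_{jj}` only see the traces, and cancel. -/
lemma brstMode_neg_one {j i : Fin l} (p q : Fin n) {v : Va n l k}
    (hv : v ∈ blockVacuum n l k (j + 1)) :
    brstMode n l k j i p q (-1) v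
      = (∑ a ∈ Finset.Ico i j, ∑ r : Fin n, eA n l k a i r q (-1) • psiA n l k j a p r 0 • v)
        - (∑ a ∈ Finset.Ioc i j, ∑ r : Fin n, psiA n l k a i r q 0 • eA n l k j a p r (-1) • v)
        + alpha n l k • psiA n l k j i p q (-1) • v
        + (∑ a : Fin l, if (a : ℕ) = j + 1 then psiA n l k a i p q 0 • v else 0)
        - (∑ a : Fin l, if (a : ℕ) + 1 = i then psiA n l k j a p q 0 • v else 0) := by
  have h1 : ∀ a ∈ Finset.Ico i j, ∀ r : Fin n,
      modeEPsi n l (eA n l k a i r q) (psiA n l k j a p r) (-1) v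
        = eA n l k a i r q (-1) • psiA n l k j a p r 0 • v
          + if a = i ∧ r = q then annihPart (psiA n l k j i p q) (eA n l k j j p p) v else 0 := by
    intro a ha r
    rw [Finset.mem_Ico] at ha
    rw [modeEPsi_neg_one (isField_eA _ _ _ _) fun s hs => psiA_smul_eq_zero le_rfl _ _ hv hs]
    congr 1
    split_ifs with h
    · rw [h.1, h.2]
      exact annihPart_congr fun s hs => eA_diag_smul_eq (ha.1.trans ha.2.le) le_rfl _ _ hv hs
    · exact annihPart_eq_zero fun s hs => eA_smul_eq_zero ha.1 ha.2.le h hv hs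
  have h2 : ∀ a ∈ Finset.Ioc i j, ∀ r : Fin n,
      modePsiE n l (psiA n l k a i r q) (eA n l k j a p r) (-1) v
        = psiA n l k a i r q 0 • eA n l k j a p r (-1) • v
          + if a = j ∧ r = p then annihPart (psiA n l k j i p q) (eA n l k j j p p) v else 0 := by
    intro a ha r
    rw [Finset.mem_Ioc] at ha
    rw [modePsiE_neg_one (isField_eA _ _ _ _) fun s hs => psiA_smul_eq_zero ha.2 _ _ hv hs]
    congr 1
    split_ifs with h
    · rw [h.1, h.2]
    · exact annihPart_eq_zero fun s hs =>
        eA_smul_eq_zero ha.2 le_rfl (fun h' => h ⟨h'.1.symm, h'.2.symm⟩) hv hs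
  set G := annihPart (psiA n l k j i p q) (eA n l k j j p p) v
  have h3 : ∀ (S : Finset (Fin l)) (b : Fin l) (t : Fin n),
      ∑ a ∈ S, ∑ r : Fin n, (if a = b ∧ r = t then G else 0) = if b ∈ S then G else 0 := by
    intro S b t
    simp [ite_and, Finset.sum_ite_eq']
  have h4 : i ∈ Finset.Ico i j ↔ j ∈ Finset.Ioc i j := by simp
  rw [brstMode, Finset.sum_congr rfl fun a ha => Finset.sum_congr rfl fun r _ => h1 a ha r,
    Finset.sum_congr rfl fun a ha => Finset.sum_congr rfl fun r _ => h2 a ha r]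
  simp only [Finset.sum_add_distrib, h3, h4, add_sub_add_right_eq_sub]
  simp

end Blocks

/-! ### Column-determinants of Hessenberg matrices -/

section ColumnDeterminants

variable {R : Type*} [Ring R]

/-- Laplace expansion of the column-determinant along the first column. -/
lemma cdet_succ {m : ℕ} (A : Matrix (Fin (m + 1)) (Fin (m + 1)) R) :
    cdet (m + 1) A = ∑ j : Fin (m + 1), (-1 : ℤ) ^ (j : ℕ) •
      (A j 0 * cdet m (A.submatrix j.succAbove Fin.succ)) := by
  rw [cdet, ← Equiv.Perm.decomposeFin.symm.sum_comp, Fintype.sum_prod_type]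
  refine Finset.sum_congr rfl fun j _ => Fin.cases ?_ (fun i => ?_) j
  · simp only [cdet, List.ofFn_succ, List.prod_cons, Finset.mul_sum,
      Equiv.Perm.decomposeFin_symm_apply_zero, Equiv.Perm.decomposeFin_symm_apply_succ,
      Equiv.Perm.decomposeFin.symm_sign, Equiv.swap_self, Fin.succAbove_zero, if_true, one_mul,
      Fin.val_zero, pow_zero, one_smul, mul_smul_comm, Matrix.submatrix_apply, Equiv.refl_apply]
  · obtain ⟨m, rfl⟩ : ∃ m', m = m' + 1 := ⟨m - 1, by have := i.2; omega⟩
    -- the two parametrizations of the permutations with `σ 0 = i + 1` differ by a cycle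
    symm
    rw [cdet, ← Equiv.sum_comp (Equiv.mulLeft i.cycleRange), Finset.mul_sum, Finset.smul_sum]
    refine Finset.sum_congr rfl fun σ _ => ?_
    rw [mul_smul_comm, smul_smul, Equiv.Perm.decomposeFin.symm_sign, if_neg (Fin.succ_ne_zero i)]
    simp only [List.ofFn_succ, List.prod_cons, Equiv.Perm.decomposeFin_symm_apply_zero,
      Equiv.Perm.decomposeFin_symm_apply_succ, Equiv.coe_mulLeft, Equiv.Perm.sign_mul,
      Fin.sign_cycleRange, Matrix.submatrix_apply, Equiv.Perm.mul_apply, Fin.succAbove_cycleRange]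
    congr 1
    · push_cast
      rw [Fin.val_succ, pow_succ', mul_assoc, ← mul_assoc ((-1 : ℤ) ^ (i : ℕ)), ← pow_add,
        ← two_mul, pow_mul]
      simp

lemma cdet_zero (A : Matrix (Fin 0) (Fin 0) R) : cdet 0 A = 1 := by
  simp [cdet]

lemma cdet_eq_zero_of_row {m : ℕ} (A : Matrix (Fin m) (Fin m) R) (a : Fin m)
    (h : ∀ b, A a b = 0) : cdet m A = 0 := by
  refine Finset.sum_eq_zero fun σ _ => ?_
  rw [List.prod_eq_zero, smul_zero]
  rw [List.mem_ofFn]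
  exact ⟨σ.symm a, by simp [h]⟩

lemma cdet_of_row_zero {m : ℕ} (A : Matrix (Fin (m + 1)) (Fin (m + 1)) R)
    (h : ∀ b, b ≠ 0 → A 0 b = 0) :
    cdet (m + 1) A = A 0 0 * cdet m (A.submatrix Fin.succ Fin.succ) := by
  rw [cdet_succ, Finset.sum_eq_single 0]
  · simp
  · intro j _ hj
    obtain ⟨m, rfl⟩ : ∃ m', m = m' + 1 := ⟨m - 1, by have := j.2; omega⟩
    rw [cdet_eq_zero_of_row _ 0, mul_zero, smul_zero]
    intro b
    rw [Matrix.submatrix_apply, Fin.succAbove_ne_zero_zero hj]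
    exact h _ (Fin.succ_ne_zero b)
  · simp

/-- The infinite matrix with the entries of `B` in its lower triangular part, `-1` on the first
superdiagonal and `0` above it. -/
def hessExt {l : ℕ} (B : Matrix (Fin l) (Fin l) R) (a c : ℕ) : R :=
  if c = a + 1 then -1 else if a + 1 < c then 0 else
    if h : a < l ∧ c < l then B ⟨a, h.1⟩ ⟨c, h.2⟩ else 0

/-- The column-determinant of a diagonal block of an infinite matrix. -/
def blockDet (b : ℕ → ℕ → R) (i m : ℕ) : R :=
  cdet m (Matrix.of fun a c : Fin m => b (i + a) (i + c))

lemma blockDet_minor {b : ℕ → ℕ → R} (h1 : ∀ a, b a (a + 1) = -1)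
    (h0 : ∀ a c, a + 1 < c → b a c = 0) (m : ℕ) (i : ℕ) (j : Fin (m + 1)) :
    cdet m ((Matrix.of fun a c : Fin (m + 1) => b (i + a) (i + c)).submatrix j.succAbove Fin.succ)
      = (-1 : ℤ) ^ (j : ℕ) • blockDet b (i + j + 1) (m - j) := by
  induction m generalizing i with
  | zero =>
    obtain rfl : j = 0 := Fin.ext (by omega)
    simp [blockDet, cdet_zero]
  | succ m ih =>
    induction j using Fin.cases with
    | zero =>
      simp only [Fin.val_zero, pow_zero, one_smul, Nat.sub_zero, blockDet]
      congr 1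
      ext a c
      simp only [Matrix.submatrix_apply, Matrix.of_apply, Fin.succAbove_zero, Fin.val_succ]
      congr 1 <;> omega
    | succ j =>
      rw [cdet_of_row_zero]
      · have e : (((Matrix.of fun a c : Fin (m + 1 + 1) => b (i + a) (i + c)).submatrix
            j.succ.succAbove Fin.succ).submatrix Fin.succ Fin.succ)
            = (Matrix.of fun a c : Fin (m + 1) => b (i + 1 + a) (i + 1 + c)).submatrix
              j.succAbove Fin.succ := by
          ext a c
          simp only [Matrix.submatrix_apply, Matrix.of_apply, Fin.succ_succAbove_succ,
            Fin.val_succ]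
          congr 1 <;> omega
        rw [e, ih]
        simp only [Matrix.submatrix_apply, Matrix.of_apply, Fin.succ_succAbove_zero, Fin.val_zero,
          Fin.val_succ, add_zero, zero_add, h1, pow_succ', Nat.add_sub_add_right]
        rw [show i + 1 + (j : ℕ) + 1 = i + (j + 1) + 1 by omega]
        simp
      · intro c hc
        have hc' : (c : ℕ) ≠ 0 := fun h => hc (Fin.ext h)
        simp only [Matrix.submatrix_apply, Matrix.of_apply, Fin.succ_succAbove_zero, Fin.val_zero,
          Fin.val_succ]
        exact h0 _ _ (by omega)

lemma blockDet_succ {b : ℕ → ℕ → R} (h1 : ∀ a, b a (a + 1) = -1)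
    (h0 : ∀ a c, a + 1 < c → b a c = 0) (i m : ℕ) :
    blockDet b i (m + 1)
      = ∑ j : Fin (m + 1), b (i + j) i * blockDet b (i + j + 1) (m - j) := by
  rw [blockDet, cdet_succ]
  refine Finset.sum_congr rfl fun j _ => ?_
  rw [blockDet_minor h1 h0, mul_smul_comm, smul_smul, ← pow_add, ← two_mul, pow_mul]
  simp

/-- The column-determinants `D i` of the lower right corners of a lower Hessenberg matrix with
`-1` on the superdiagonal satisfy the recursion of noncommutative continuants. -/
lemma exists_hessenberg_recursion {l : ℕ} (B : Matrix (Fin l) (Fin l) R)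
    (h1 : ∀ a c : Fin l, (c : ℕ) = a + 1 → B a c = -1)
    (h0 : ∀ a c : Fin l, (a : ℕ) + 1 < c → B a c = 0) :
    ∃ D : ℕ → R, D 0 = cdet l B ∧ D l = 1 ∧
      ∀ i : Fin l, D i = ∑ j ∈ Finset.Ici i, B j i * D (j + 1) := by
  have h1' : ∀ a, hessExt B a (a + 1) = -1 := fun a => if_pos rfl
  have h0' : ∀ a c, a + 1 < c → hessExt B a c = 0 := fun a c h => by
    rw [hessExt, if_neg (by omega), if_pos h]
  refine ⟨fun i => blockDet (hessExt B) i (l - i), ?_, ?_, fun i => ?_⟩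
  · simp only [blockDet, Nat.sub_zero]
    congr 1
    ext a c
    simp only [Matrix.of_apply, zero_add, hessExt, a.2, c.2, and_self, dif_pos]
    split_ifs with h h'
    · exact (h1 a c h).symm
    · exact (h0 a c h').symm
    · rfl
  · have h : ∀ m, m = 0 → blockDet (hessExt B) l m = 1 := fun m hm => by
      subst hm
      exact cdet_zero _
    exact h _ (Nat.sub_self l)
  · obtain ⟨m, hm⟩ : ∃ m, l - i = m + 1 := ⟨l - i - 1, by have := i.2; omega⟩
    simp only [hm]
    rw [blockDet_succ h1' h0']
    refine Finset.sum_bij (fun j _ => (⟨i + j, by omega⟩ : Fin l)) ?_ ?_ ?_ ?_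
    · intro j _
      simp [Fin.le_def]
    · intro j _ j' _ h
      simpa [Fin.ext_iff] using h
    · intro j hj
      rw [Finset.mem_Ici, Fin.le_def] at hj
      exact ⟨⟨j - i, by omega⟩, Finset.mem_univ _, Fin.ext (by simp; omega)⟩
    · intro j _
      have e : hessExt B (i + j) i = B ⟨i + j, by omega⟩ i := by
        rw [hessExt, if_neg (by omega), if_neg (by omega), dif_pos ⟨by omega, i.2⟩]
      rw [e, show m - (j : ℕ) = l - (i + j + 1) by omega]

/-- The tails of an ordered product. -/
lemma exists_prod_recursion {l : ℕ} (f : Fin l → R) :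
    ∃ D : ℕ → R, D 0 = (List.ofFn f).prod ∧ D l = 1 ∧
      ∀ i : Fin l, D i = f i * D (i + 1) := by
  refine ⟨fun i => ((List.ofFn f).drop i).prod, by simp, ?_, fun i => ?_⟩
  · simp [List.drop_eq_nil_of_le]
  · simp only
    rw [List.drop_eq_getElem_cons (by simp), List.prod_cons]
    simp

end ColumnDeterminants

/-! ### The differential of the corner determinants -/

section Differential

variable {n l : ℕ} {k : ℂ}

/-- The vector `∑_{c > b} ∑_t (ψ_{cb}[0] ⊗ e_{tx}) u_{c+1,t}`, for a family of vectors `u`; it is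
minus the image under `Q` of the generators attached to the blocks following `b`. -/
def psiSum (u : ℕ → Fin n → Va n l k) (b : Fin l) (x : Fin n) : Va n l k :=
  ∑ c ∈ Finset.Ioi b, ∑ t : Fin n, psiA n l k c b t x 0 • u (c + 1) t

lemma psiA_self (i : Fin l) (p q : Fin n) (m : ℤ) : psiA n l k i i p q m = 0 := by
  rw [psiA, eM, dif_neg (lt_irrefl i), odA_zero]

lemma transA_psiSum (u : ℕ → Fin n → Va n l k) (b : Fin l) (x : Fin n) :
    transA n l k (psiSum u b x)
      = (∑ c ∈ Finset.Ioi b, ∑ t : Fin n, psiA n l k c b t x (-1) • u (c + 1) t)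
        + psiSum (fun c t => transA n l k (u c t)) b x := by
  simp only [psiSum, map_sum, transA_psiA, Finset.sum_add_distrib]
  simp

/-- The cancellation behind `Q W = 0`.  The vectors `u`, `u'`, `u''` are the coefficients of
`τ^s`, `τ^(s-1)` and the translate of the coefficient of `τ^s`. -/
lemma brst_cancellation (i : Fin l) (x : Fin n) (u u' u'' : ℕ → Fin n → Va n l k)
    (hu : ∀ j : Fin l, ∀ r, u (j + 1) r ∈ blockVacuum n l k (j + 1))
    (hrec : ∀ a : Fin l, ∀ t, u a t = (∑ j ∈ Finset.Ici a, ∑ r : Fin n,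
        eA n l k j a r t (-1) • u (j + 1) r) + (u' (a + 1) t + alpha n l k • u'' (a + 1) t)) :
    (∑ j ∈ Finset.Ici i, ∑ r : Fin n, (brstMode n l k j i r x (-1) (u (j + 1) r)
        + eA n l k j i r x (-1) • (-psiSum u j r)))
      + (-psiSum u' i x - alpha n l k •
        ((∑ c ∈ Finset.Ioi i, ∑ t : Fin n, psiA n l k c i t x (-1) • u (c + 1) t)
          + psiSum u'' i x))
      = -∑ b : Fin l, if (b : ℕ) + 1 = i then psiSum u b x else 0 := by
  -- the terms `e_{ai} ψ_{ja}` cancel against `Q` of the later corners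
  have h1 : ∑ j ∈ Finset.Ici i, ∑ r : Fin n, ∑ a ∈ Finset.Ico i j, ∑ t : Fin n,
        eA n l k a i t x (-1) • psiA n l k j a r t 0 • u (j + 1) r
      = ∑ j ∈ Finset.Ici i, ∑ r : Fin n, eA n l k j i r x (-1) • psiSum u j r := by
    simp only [psiSum, Finset.smul_sum]
    calc _ = ∑ j ∈ Finset.Ici i, ∑ a ∈ Finset.Ico i j, ∑ t : Fin n, ∑ r : Fin n,
          eA n l k a i t x (-1) • psiA n l k j a r t 0 • u (j + 1) r := by
          refine Finset.sum_congr rfl fun j _ => ?_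
          rw [Finset.sum_comm]
          exact Finset.sum_congr rfl fun a _ => Finset.sum_comm
      _ = ∑ a ∈ Finset.Ici i, ∑ j ∈ Finset.Ioi a, ∑ t : Fin n, ∑ r : Fin n,
          eA n l k a i t x (-1) • psiA n l k j a r t 0 • u (j + 1) r := by
          refine Finset.sum_comm' fun j a => ?_
          simp only [Finset.mem_Ici, Finset.mem_Ico, Finset.mem_Ioi]
          omega
      _ = _ := Finset.sum_congr rfl fun a _ => Finset.sum_comm
  -- the terms `ψ_{ai} e_{ja}` form one part of `ψ_{ai} D_a`, expanded by the recursion in `h6`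
  have h2 : ∑ j ∈ Finset.Ici i, ∑ r : Fin n, ∑ a ∈ Finset.Ioc i j, ∑ t : Fin n,
        psiA n l k a i t x 0 • eA n l k j a r t (-1) • u (j + 1) r
      = ∑ a ∈ Finset.Ioi i, ∑ t : Fin n, psiA n l k a i t x 0 •
        ∑ j ∈ Finset.Ici a, ∑ r : Fin n, eA n l k j a r t (-1) • u (j + 1) r := by
    simp only [Finset.smul_sum]
    calc _ = ∑ j ∈ Finset.Ici i, ∑ a ∈ Finset.Ioc i j, ∑ t : Fin n, ∑ r : Fin n,
          psiA n l k a i t x 0 • eA n l k j a r t (-1) • u (j + 1) r := by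
          refine Finset.sum_congr rfl fun j _ => ?_
          rw [Finset.sum_comm]
          exact Finset.sum_congr rfl fun a _ => Finset.sum_comm
      _ = ∑ a ∈ Finset.Ioi i, ∑ j ∈ Finset.Ici a, ∑ t : Fin n, ∑ r : Fin n,
          psiA n l k a i t x 0 • eA n l k j a r t (-1) • u (j + 1) r := by
          refine Finset.sum_comm' fun j a => ?_
          simp only [Finset.mem_Ici, Finset.mem_Ioc, Finset.mem_Ioi]
          omega
      _ = _ := Finset.sum_congr rfl fun a _ => Finset.sum_comm
  -- the terms `α ψ_{ji}[-1]`, where `ψ_{ii} = 0`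
  have h3 : ∑ j ∈ Finset.Ici i, ∑ r : Fin n, alpha n l k • psiA n l k j i r x (-1) • u (j + 1) r
      = alpha n l k •
        ∑ c ∈ Finset.Ioi i, ∑ t : Fin n, psiA n l k c i t x (-1) • u (c + 1) t := by
    rw [← Finset.Ioi_insert, Finset.sum_insert (by simp)]
    simp only [psiA_self, zero_smul, smul_zero, Finset.sum_const_zero, zero_add,
      ← Finset.smul_sum]
  -- the terms `ψ_{j+1,i}`
  have h4 : ∑ j ∈ Finset.Ici i, ∑ r : Fin n, (∑ a : Fin l,
        if (a : ℕ) = j + 1 then psiA n l k a i r x 0 • u (j + 1) r else 0)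
      = ∑ a ∈ Finset.Ioi i, ∑ r : Fin n, psiA n l k a i r x 0 • u a r := by
    simp only [Finset.sum_comm (s := (Finset.univ : Finset (Fin n)))]
    rw [Finset.sum_comm' (s' := fun a => Finset.Ici i) (t' := Finset.univ) (by simp),
      ← Finset.sum_subset (Finset.subset_univ (Finset.Ioi i))]
    · refine Finset.sum_congr rfl fun a ha => ?_
      rw [Finset.mem_Ioi, Fin.lt_def] at ha
      rw [Finset.sum_eq_single (⟨a - 1, by omega⟩ : Fin l)]
      · have e : (a : ℕ) - 1 + 1 = a := by omega
        simp only [e, if_true]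
      · intro j _ hj
        have : (a : ℕ) ≠ j + 1 := fun h => hj (Fin.ext (by simp; omega))
        simp [this]
      · intro h
        exact absurd (Finset.mem_Ici.mpr (Fin.le_def.mpr (by simp; omega))) h
    · intro a _ ha
      rw [Finset.mem_Ioi, Fin.lt_def] at ha
      refine Finset.sum_eq_zero fun j hj => Finset.sum_eq_zero fun r _ => if_neg ?_
      rw [Finset.mem_Ici, Fin.le_def] at hj
      omega
  -- the terms `ψ_{j,i-1}`, which survive
  have h5 : ∑ j ∈ Finset.Ici i, ∑ r : Fin n, (∑ a : Fin l,
        if (a : ℕ) + 1 = i then psiA n l k j a r x 0 • u (j + 1) r else 0)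
      = ∑ b : Fin l, if (b : ℕ) + 1 = i then psiSum u b x else 0 := by
    simp only [Finset.sum_comm (s := (Finset.univ : Finset (Fin n)))]
    rw [Finset.sum_comm' (s' := fun a => Finset.Ici i) (t' := Finset.univ) (by simp)]
    refine Finset.sum_congr rfl fun b _ => ?_
    split_ifs with h
    · have e : Finset.Ici i = Finset.Ioi b := by
        ext j
        rw [Finset.mem_Ici, Finset.mem_Ioi, Fin.le_def, Fin.lt_def]
        omega
      rw [e, psiSum]
    · simp
  have h6 : ∑ a ∈ Finset.Ioi i, ∑ r : Fin n, psiA n l k a i r x 0 • u a r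
      = (∑ a ∈ Finset.Ioi i, ∑ t : Fin n, psiA n l k a i t x 0 •
        ∑ j ∈ Finset.Ici a, ∑ r : Fin n, eA n l k j a r t (-1) • u (j + 1) r)
        + (psiSum u' i x + alpha n l k • psiSum u'' i x) := by
    simp only [psiSum, Finset.smul_sum (r := alpha n l k), ← Finset.sum_add_distrib]
    refine Finset.sum_congr rfl fun a _ => Finset.sum_congr rfl fun t _ => ?_
    rw [hrec a t, smul_add, smul_add, Va_smul_comm]
  have hb : ∀ j : Fin l, ∀ r, _ := fun j r => brstMode_neg_one (i := i) r x (hu j r)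
  simp only [hb, Finset.sum_add_distrib, Finset.sum_sub_distrib, h1, h2, h3, h4, h5, h6, smul_neg,
    Finset.sum_neg_distrib, smul_add]
  abel

variable (W : ℕ → ℕ → Fin n → Vb n l k)

/-- The recursion satisfied by the coefficients of the powers of `α τ` in the column-determinants
of the lower right corners of `B`. -/
def CornerRecursion : Prop :=
  ∀ (i : Fin l) (s : ℕ) (x : Fin n), W i s x
    = (∑ j ∈ Finset.Ici i, ∑ r : Fin n,
        AffAlg.mode (formB n l k) (eB n l j i r x) (-1) • W (j + 1) s r)
      + ((if s = 0 then 0 else W (i + 1) (s - 1) x)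
        + alpha n l k • VAff.trans _ (W (i + 1) s x))

variable {W}

lemma CornerRecursion.mem_blockVacuum (hrec : CornerRecursion W)
    (hl : ∀ s x, ∃ c : ℂ, W l s x = c • VAff.vac _) {i : ℕ} (hi : i ≤ l) (s : ℕ) (x : Fin n) :
    VbToVa n l k (W i s x) ∈ blockVacuum n l k i := by
  induction hm : l - i using Nat.strong_induction_on generalizing i s x with
  | _ m ih =>
    subst hm
    have ih' : ∀ j : Fin l, i ≤ j → ∀ s x,
        VbToVa n l k (W (j + 1) s x) ∈ blockVacuum n l k i := fun j hj s x =>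
      blockVacuum_anti (by omega) (ih (l - (j + 1)) (by omega) (i := j + 1) (by omega) s x rfl)
    rcases hi.eq_or_lt with rfl | hi
    · obtain ⟨c, hc⟩ := hl s x
      rw [hc, map_smul, VbToVa_vac]
      exact Submodule.smul_mem _ _ (vacA_mem_blockVacuum _)
    · rw [show i = ((⟨i, hi⟩ : Fin l) : ℕ) from rfl, hrec]
      simp only [map_add, map_sum, VbToVa_mode, map_smul, VbToVa_trans]
      refine Submodule.add_mem _ (Submodule.sum_mem _ fun j hj => Submodule.sum_mem _ fun r _ => ?_)
        (Submodule.add_mem _ ?_ (Submodule.smul_mem _ _ (transA_mem_blockVacuum ?_)))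
      · rw [Finset.mem_Ici] at hj
        exact evA_smul_mem_blockVacuum (eB_highSupp hj _ _) _ (ih' j hj s r)
      · split_ifs
        · rw [map_zero]
          exact Submodule.zero_mem _
        · exact ih' ⟨i, hi⟩ le_rfl _ _
      · exact ih' ⟨i, hi⟩ le_rfl _ _

lemma QGraph.sum {ι : Type*} (S : Finset ι) (v : ι → Vb n l k) (w : ι → Va n l k)
    (h : ∀ a ∈ S, QGraph n l k (v a) (w a)) :
    QGraph n l k (∑ a ∈ S, v a) (∑ a ∈ S, w a) := by
  classical
  induction S using Finset.induction_on with
  | empty => simpa using QGraph.smul 0 (QGraph.vac (n := n) (l := l) (k := k))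
  | insert a S ha ih =>
    rw [Finset.sum_insert ha, Finset.sum_insert ha]
    exact QGraph.add (h a (Finset.mem_insert_self a S))
      (ih fun b hb => h b (Finset.mem_insert_of_mem hb))

/-- The differential of the coefficients of the column-determinants of the corners of `B`. -/
lemma CornerRecursion.qGraph (hrec : CornerRecursion W)
    (hl : ∀ s x, ∃ c : ℂ, W l s x = c • VAff.vac _) {i : ℕ} (hi : i ≤ l) (s : ℕ) (x : Fin n) :
    QGraph n l k (W i s x) (-∑ b : Fin l, if (b : ℕ) + 1 = i then
      psiSum (fun c t => VbToVa n l k (W c s t)) b x else 0) := by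
  induction hm : l - i using Nat.strong_induction_on generalizing i s x with
  | _ m ih =>
    subst hm
    rcases hi.eq_or_lt with rfl | hi
    · obtain ⟨c, hc⟩ := hl s x
      have h0 : (∑ b : Fin i, if (b : ℕ) + 1 = i then
          psiSum (fun c t => VbToVa n i k (W c s t)) b x else 0) = 0 := by
        refine Finset.sum_eq_zero fun b _ => ?_
        split_ifs with hb
        · rw [psiSum, Finset.sum_eq_zero]
          intro c hc
          rw [Finset.mem_Ioi, Fin.lt_def] at hc
          omega
        · rfl
      rw [h0, hc, neg_zero]
      simpa using QGraph.smul c (QGraph.vac (n := n) (l := i) (k := k))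
    · have ih' : ∀ j : Fin l, i ≤ j → ∀ s r, QGraph n l k (W (j + 1) s r)
          (-psiSum (fun c t => VbToVa n l k (W c s t)) j r) := by
        intro j hj s r
        have h := ih (l - (j + 1)) (by omega) (i := j + 1) (by omega) s r rfl
        rw [Finset.sum_eq_single j (fun b _ hb => if_neg fun h => hb (Fin.ext (by omega)))
          (by simp), if_pos rfl] at h
        exact h
      have hprev : QGraph n l k (if s = 0 then 0 else W (i + 1) (s - 1) x)
          (-psiSum (fun c t => VbToVa n l k (if s = 0 then 0 else W c (s - 1) t)) ⟨i, hi⟩ x) := by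
        split_ifs with hs
        · simpa [psiSum] using QGraph.smul 0 (QGraph.vac (n := n) (l := l) (k := k))
        · exact ih' ⟨i, hi⟩ le_rfl _ _
      have htrans := QGraph.smul (alpha n l k) (ih' ⟨i, hi⟩ le_rfl s x).trans
      have hsum := QGraph.sum (Finset.Ici (⟨i, hi⟩ : Fin l)) _ _ fun j hj =>
        QGraph.sum Finset.univ _ _ fun r _ => QGraph.mode j ⟨i, hi⟩ (Finset.mem_Ici.mp hj) r x (-1)
          (ih' j (Fin.le_def.mp (Finset.mem_Ici.mp hj)) s r)
      have key := QGraph.add hsum (QGraph.add hprev htrans)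
      have hid := brst_cancellation (k := k) (⟨i, hi⟩ : Fin l) x
        (fun c t => VbToVa n l k (W c s t))
        (fun c t => VbToVa n l k (if s = 0 then 0 else W c (s - 1) t))
        (fun c t => transA n l k (VbToVa n l k (W c s t)))
        (fun j r => hrec.mem_blockVacuum hl j.2 s r)
        (fun a t => by
          rw [hrec a s t]
          simp only [map_add, map_sum, VbToVa_mode, map_smul, VbToVa_trans]
          rfl)
      have hW := hrec ⟨i, hi⟩ s x
      simp only at hW hid
      rw [← hW] at key
      rw [← hid]
      convert key using 2
      rw [sub_eq_add_neg, map_neg, smul_neg, transA_psiSum]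

/-- The coefficients of the column-determinant of `B` lie in the `W`-algebra. -/
theorem CornerRecursion.mem_W (hrec : CornerRecursion W)
    (hl : ∀ s x, ∃ c : ℂ, W l s x = c • VAff.vac _) (s : ℕ) (x : Fin n) :
    W 0 s x ∈ RectW.W n l k := by
  have h := hrec.qGraph hl (Nat.zero_le l) s x
  change QGraph n l k (W 0 s x) 0
  simpa using h

end Differential

/-! ### Coefficients in `A ⊗ ℂ[τ]` -/

section OreCoefficients

namespace Ore

variable {A : Type*} [Ring A] [Algebra ℂ A] (d : Der A)

lemma of_mul (a : A) (P : Ore A d) : of d a * P = baseL a P := by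
  change mulL d (Polynomial.C a) P = _
  rw [← Polynomial.monomial_zero_left, mulL_monomial, pow_zero, mul_one]

lemma tau_mul (P : Ore A d) : tau d * P = tauL d P := by
  change mulL d Polynomial.X P = _
  rw [← Polynomial.monomial_one_one_eq_X, mulL_monomial, pow_one, map_one, one_mul]

lemma smul_mul (c : ℂ) (P Q : Ore A d) : (c • P) * Q = c • (P * Q) := by
  have h0 : ∀ p : Polynomial A, c • p = baseL (algebraMap ℂ A c) p := fun p => by
    rw [baseL_apply]
    ext s
    rw [Polynomial.coeff_smul, Polynomial.coeff_C_mul, Algebra.smul_def]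
  have h : ∀ P : Ore A d, c • P = of d (algebraMap ℂ A c) * P := fun P =>
    (h0 P).trans (of_mul d _ P).symm
  rw [h, h, mul_assoc]

variable {d}

lemma coeff_of_mul (a : A) (P : Ore A d) (s : ℕ) : coeff s (of d a * P) = a * coeff s P := by
  rw [of_mul]
  exact Polynomial.coeff_C_mul (P : Polynomial A)

lemma coeff_coeffD (P : Polynomial A) (s : ℕ) :
    (coeffD d P).coeff s = d.toLin (P.coeff s) := by
  induction P using Polynomial.induction_on' with
  | add p q hp hq => simp only [map_add, Polynomial.coeff_add, hp, hq]
  | monomial t b =>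
    rw [coeffD_monomial, Polynomial.coeff_monomial, Polynomial.coeff_monomial]
    split_ifs
    · rfl
    · rw [map_zero]

lemma coeff_tauL (p : Polynomial A) (s : ℕ) : (tauL d p).coeff s
    = (if s = 0 then 0 else p.coeff (s - 1)) + d.toLin (p.coeff s) := by
  change (p * Polynomial.X + coeffD d p).coeff s = _
  rw [Polynomial.coeff_add, coeff_coeffD]
  congr 1
  cases s with
  | zero => rw [Polynomial.coeff_mul_X_zero, if_pos rfl]
  | succ s => rw [Polynomial.coeff_mul_X, if_neg s.succ_ne_zero, Nat.add_sub_cancel]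

lemma coeff_tau_mul (P : Ore A d) (s : ℕ) :
    coeff s (tau d * P) = (if s = 0 then 0 else coeff (s - 1) P) + d.toLin (coeff s P) := by
  rw [tau_mul]
  exact coeff_tauL P s

lemma coeff_add (P Q : Ore A d) (s : ℕ) : coeff s (P + Q) = coeff s P + coeff s Q :=
  Polynomial.coeff_add _ _ _

lemma coeff_smul (c : ℂ) (P : Ore A d) (s : ℕ) : coeff s (c • P) = c • coeff s P :=
  Polynomial.coeff_smul _ _ _

lemma coeff_sum {ι : Type*} (S : Finset ι) (P : ι → Ore A d) (s : ℕ) :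
    coeff s (∑ a ∈ S, P a) = ∑ a ∈ S, coeff s (P a) :=
  Polynomial.finsetSum_coeff _ _ _

lemma coeff_one (s : ℕ) : coeff s (1 : Ore A d) = if s = 0 then 1 else 0 :=
  Polynomial.coeff_one

lemma coeff_diag_mul (c : ℂ) (a : A) (P : Ore A d) (s : ℕ) :
    coeff s ((c • tau d + of d a) * P) = a * coeff s P
      + c • ((if s = 0 then 0 else coeff (s - 1) P) + d.toLin (coeff s P)) := by
  rw [add_mul, smul_mul, coeff_add, coeff_smul, coeff_tau_mul, coeff_of_mul, add_comm]

end Ore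

lemma Der.map_algebraMap {A : Type*} [Ring A] [Algebra ℂ A] (d : Der A) (c : ℂ) :
    d.toLin (algebraMap ℂ A c) = 0 := by
  rw [Algebra.algebraMap_eq_smul_one, map_smul, d.map_one, smul_zero]

end OreCoefficients

/-! ### The recursion for the coefficients -/

section CornerCoefficients

variable {l : ℕ}

lemma tauDer_ι_apply (β : ℂ) (z : NegLoop l) :
    (tauDer l β).toLin (TensorAlgebra.ι ℂ z) = TensorAlgebra.ι ℂ (β • shift l z) := by
  simp [tauDer, dualHom]

lemma tauDer_eq_smul (β : ℂ) (u : TAlg l) :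
    (tauDer l β).toLin u = β • (tauDer l 1).toLin u := by
  induction u using TensorAlgebra.induction with
  | algebraMap c => rw [Der.map_algebraMap, Der.map_algebraMap, smul_zero]
  | ι z => rw [tauDer_ι_apply, tauDer_ι_apply, one_smul, map_smul]
  | mul a b ha hb => simp only [Der.leibniz, ha, hb, smul_add, smul_mul_assoc, mul_smul_comm]
  | add a b ha hb => rw [map_add, map_add, smul_add, ha, hb]

/-- The recursion for the coefficients of the powers of `τ` in the continuants with entries `E` and
`c τ` added on the diagonal, where `[τ, x[-m]] = β m x[-m-1]`. -/
structure CoeffRecursion (E : Fin l → Fin l → TAlg l) (β c : ℂ) (f : ℕ → ℕ → TAlg l) : Prop where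
  last : ∀ s, f l s = if s = 0 then 1 else 0
  step : ∀ (i : Fin l) (s : ℕ), f i s = (∑ j ∈ Finset.Ici i, E j i * f (j + 1) s)
    + c • ((if s = 0 then 0 else f (i + 1) (s - 1)) + (tauDer l β).toLin (f (i + 1) s))

namespace CoeffRecursion

variable {E : Fin l → Fin l → TAlg l} {β c : ℂ} {f g : ℕ → ℕ → TAlg l}

lemma eq (hf : CoeffRecursion E β c f) (hg : CoeffRecursion E β c g) {i : ℕ} (hi : i ≤ l)
    (s : ℕ) : f i s = g i s := by
  induction hm : l - i using Nat.strong_induction_on generalizing i s with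
  | _ m ih =>
    subst hm
    rcases hi.eq_or_lt with rfl | hi
    · rw [hf.last, hg.last]
    · have ih' : ∀ j : Fin l, i ≤ j → ∀ s, f (j + 1) s = g (j + 1) s := fun j hj s =>
        ih (l - (j + 1)) (by omega) (by omega) s rfl
      have h1 := hf.step ⟨i, hi⟩ s
      have h2 := hg.step ⟨i, hi⟩ s
      rw [Finset.sum_congr rfl fun j hj => by rw [ih' j (Fin.le_def.mp (Finset.mem_Ici.mp hj)) s],
        ih' ⟨i, hi⟩ le_rfl, ih' ⟨i, hi⟩ le_rfl] at h1
      exact h1.trans h2.symm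

lemma eq_zero (hf : CoeffRecursion E β c f) {i : ℕ} (hi : i ≤ l) {s : ℕ} (hs : l < i + s) :
    f i s = 0 := by
  induction hm : l - i using Nat.strong_induction_on generalizing i s with
  | _ m ih =>
    subst hm
    rcases hi.eq_or_lt with rfl | hi
    · rw [hf.last, if_neg (by omega)]
    · have ih' : ∀ j : Fin l, i ≤ j → ∀ s, l < j + 1 + s → f (j + 1) s = 0 := fun j hj s hs =>
        ih (l - (j + 1)) (by omega) (by omega) hs rfl
      have h1 := hf.step ⟨i, hi⟩ s
      rw [Finset.sum_eq_zero fun j hj => ?_, if_neg (by omega), ih' ⟨i, hi⟩ le_rfl _ ?_,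
        ih' ⟨i, hi⟩ le_rfl _ ?_, map_zero, add_zero, smul_zero, add_zero] at h1
      · exact h1
      · change l < i + 1 + s
        omega
      · change l < i + 1 + (s - 1)
        omega
      · have hij := Fin.le_def.mp (Finset.mem_Ici.mp hj)
        simp only at hij
        rw [ih' j hij _ (by omega), mul_zero]

lemma rescale (hg : CoeffRecursion E β 1 g) :
    CoeffRecursion E 1 β (fun i s => β ^ s • g i s) where
  last s := by
    rw [hg.last]
    split_ifs with h
    · rw [h, pow_zero, one_smul]
    · rw [smul_zero]
  step i s := by
    simp only [hg.step i s, one_smul, smul_add, Finset.smul_sum, mul_smul_comm, map_smul,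
      tauDer_eq_smul β]
    congr 2
    · cases s with
      | zero => simp
      | succ s => simp [pow_succ', mul_smul]
    · rw [smul_comm]

end CoeffRecursion

/-- The coefficients of the column-determinant of `B`. -/
lemma exists_coeffRecursion_cdet (β c : ℂ) :
    ∃ f, CoeffRecursion (eT l) β c f ∧ ∀ s, f 0 s = Ore.coeff s (cdet l (Bmat l β c)) := by
  obtain ⟨D, h0, hl, hD⟩ := exists_hessenberg_recursion (Bmat l β c)
    (fun a b h => by
      rw [Bmat, Matrix.of_apply, if_neg (by rw [Fin.ext_iff]; omega),
        if_neg (by rw [Fin.lt_def]; omega), if_pos h])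
    (fun a b h => by
      rw [Bmat, Matrix.of_apply, if_neg (by rw [Fin.ext_iff]; omega),
        if_neg (by rw [Fin.lt_def]; omega), if_neg (by omega)])
  refine ⟨fun i s => Ore.coeff s (D i), ⟨fun s => ?_, fun i s => ?_⟩, fun s => by simp only [h0]⟩
  · simp only [hl, Ore.coeff_one]
  · simp only [hD i]
    rw [← Finset.Ioi_insert, Finset.sum_insert (by simp), Finset.sum_insert (by simp),
      Ore.coeff_add, Ore.coeff_sum]
    have h1 : Bmat l β c i i = c • Ore.tau _ + Ore.of _ (eT l i i) := by
      rw [Bmat, Matrix.of_apply, if_pos rfl]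
    have h2 : ∀ j ∈ Finset.Ioi i, Ore.coeff s (Bmat l β c j i * D (j + 1))
        = eT l j i * Ore.coeff s (D (j + 1)) := fun j hj => by
      rw [Finset.mem_Ioi] at hj
      rw [Bmat, Matrix.of_apply, if_neg hj.ne', if_pos hj, Ore.coeff_of_mul]
    rw [h1, Ore.coeff_diag_mul, Finset.sum_congr rfl h2]
    abel

/-- The coefficients of the product of the diagonal entries of `B`. -/
lemma exists_coeffRecursion_diagProd (β c : ℂ) :
    ∃ f, CoeffRecursion (fun j i => if j = i then eT l i i else 0) β c f ∧
      ∀ s, f 0 s = Ore.coeff s (diagProd l β c) := by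
  obtain ⟨D, h0, hl, hD⟩ := exists_prod_recursion fun a : Fin l =>
    c • Ore.tau (tauDer l β) + Ore.of _ (eT l a a)
  refine ⟨fun i s => Ore.coeff s (D i), ⟨fun s => ?_, fun i s => ?_⟩, fun s => by
    simp only [h0, diagProd]⟩
  · simp only [hl, Ore.coeff_one]
  · simp only [hD i, Ore.coeff_diag_mul, ite_mul, zero_mul]
    rw [Finset.sum_ite_eq' (Finset.Ici i) i, if_pos (Finset.mem_Ici.mpr le_rfl)]

end CornerCoefficients

/-! ### The generators and the Miura transformation -/

section Vectors

variable {n l : ℕ} {k : ℂ}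

lemma UNeg.toAff_gen {L : Type*} [LieRing L] [LieAlgebra ℂ L] (κ : LinearMap.BilinForm ℂ L)
    (x : L) (s : ℕ) : UNeg.toAff κ (UNeg.gen x s) = AffAlg.mode κ x (-(s : ℤ) - 1) := by
  simp [UNeg.toAff, UNeg.gen]

lemma UNeg.toVac_apply {L : Type*} [LieRing L] [LieAlgebra ℂ L] (κ : LinearMap.BilinForm ℂ L)
    (u : UNeg L) : UNeg.toVac κ u = UNeg.toAff κ u • VAff.vac κ := rfl

lemma VAff.trans_smul {L : Type*} [LieRing L] [LieAlgebra ℂ L] (κ : LinearMap.BilinForm ℂ L)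
    (a : AffAlg κ) (v : VAff κ) :
    VAff.trans κ (a • v) = (AffAlg.der κ).toLin a • v + a • VAff.trans κ v :=
  Der.quot_smul _ _ _ _ _

lemma calT_ι_single (s : ℕ) (x : glLe l) (i j : Fin n) :
    calT n l (TensorAlgebra.ι ℂ (Finsupp.single s x)) i j = UNeg.gen (kron n l j i x) s := by
  rw [calT, TensorAlgebra.lift_ι_apply, Finsupp.lsum_single]
  rfl

lemma calT_eT {j i : Fin l} (h : i ≤ j) (x r : Fin n) :
    calT n l (eT l j i) x r = UNeg.gen (eB n l j i r x) 0 := by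
  rw [eT, dif_pos h, calT_ι_single]
  congr 1
  refine Subtype.ext ?_
  rw [eB_coe h]
  change Matrix.kronecker (Matrix.single j i 1) (Matrix.single r x 1) = _
  exact (Matrix.single_kronecker_single _ _ _ _ _ _).trans (by rw [mul_one])

lemma toAff_calT_tauDer (β : ℂ) (u : TAlg l) (i j : Fin n) :
    UNeg.toAff (formB n l k) (calT n l ((tauDer l β).toLin u) i j)
      = β • (AffAlg.der _).toLin (UNeg.toAff (formB n l k) (calT n l u i j)) := by
  induction u using TensorAlgebra.induction generalizing i j with
  | algebraMap c =>
    rw [Der.map_algebraMap, AlgHom.commutes, Matrix.algebraMap_matrix_apply]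
    split_ifs
    · rw [AlgHom.commutes, Der.map_algebraMap, smul_zero, map_zero, Matrix.zero_apply, map_zero]
    · simp
  | ι z =>
    induction z using Finsupp.induction_linear with
    | zero => simp
    | add z z' h h' => simp only [map_add, Matrix.add_apply, h, h', smul_add]
    | single s x =>
      rw [tauDer_ι, map_smul, Matrix.smul_apply, calT_ι_single, calT_ι_single, map_smul,
        UNeg.toAff_gen, UNeg.toAff_gen, AffAlg.der_mode, smul_smul]
      push_cast
      congr 2
      · ring
      · ring
  | mul a b ha hb =>
    simp only [Der.leibniz, map_add, map_mul, Matrix.add_apply, Matrix.mul_apply, map_sum, ha, hb,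
      smul_add, Finset.smul_sum, Finset.sum_add_distrib, smul_mul_assoc, mul_smul_comm]
  | add a b ha hb => simp only [map_add, Matrix.add_apply, ha, hb, smul_add]

lemma toVac_calT_tauDer (β : ℂ) (u : TAlg l) (i j : Fin n) :
    UNeg.toVac (formB n l k) (calT n l ((tauDer l β).toLin u) i j)
      = β • VAff.trans _ (UNeg.toVac (formB n l k) (calT n l u i j)) := by
  rw [UNeg.toVac_apply, UNeg.toVac_apply, toAff_calT_tauDer, VAff.trans_smul, VAff.trans_vac,
    smul_zero, add_zero, smul_assoc]

lemma toVac_calT_eT_mul {j i : Fin l} (h : i ≤ j) (u : TAlg l) (x y : Fin n) :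
    UNeg.toVac (formB n l k) (calT n l (eT l j i * u) x y)
      = ∑ r : Fin n, AffAlg.mode (formB n l k) (eB n l j i r x) (-1) •
        UNeg.toVac (formB n l k) (calT n l u r y) := by
  rw [map_mul, Matrix.mul_apply, map_sum]
  refine Finset.sum_congr rfl fun r _ => ?_
  rw [UNeg.toVac_apply, UNeg.toVac_apply, map_mul, mul_smul, calT_eT h, UNeg.toAff_gen]
  simp

lemma cornerRecursion_of_coeffRecursion {f : ℕ → ℕ → TAlg l}
    (hf : CoeffRecursion (eT l) (alpha n l k) 1 f) (y : Fin n) :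
    CornerRecursion fun i s x => UNeg.toVac (formB n l k) (calT n l (f i s) x y) := by
  intro i s x
  simp only [hf.step i s, one_smul, map_add, map_sum, Matrix.add_apply, Matrix.sum_apply,
    toVac_calT_tauDer]
  congr 1
  · exact Finset.sum_congr rfl fun j hj => toVac_calT_eT_mul (Finset.mem_Ici.mp hj) _ _ _
  · congr 1
    split_ifs
    · simp
    · rfl

theorem genWvec_mem_W (k : ℂ) (i j : Fin n) (r : Fin (l + 1)) :
    genWvec n l k i j r ∈ W n l k := by
  obtain ⟨f, hf, h0⟩ := exists_coeffRecursion_cdet (l := l) (alpha n l k) 1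
  have h := (cornerRecursion_of_coeffRecursion hf j).mem_W (fun s x => ?_) (l - r) i
  · simp only [h0] at h
    exact h
  · refine ⟨if s = 0 ∧ x = j then 1 else 0, ?_⟩
    rw [hf.last]
    by_cases hs : s = 0 <;> by_cases hx : x = j
    · subst hx
      simp only [hs, if_true, map_one, Matrix.one_apply_eq, and_self, one_smul]
      rw [UNeg.toVac_apply, map_one, one_smul]
    all_goals simp [hs, hx]

/-- The projection of `gl_{l,≤0}` onto the diagonal matrices. -/
def diagPart (l : ℕ) : glLe l →ₗ[ℂ] glLe l where
  toFun x := ⟨Matrix.diagonal fun a => (x : Matrix (Fin l) (Fin l) ℂ) a a, fun _ _ hac =>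
    Matrix.diagonal_apply_ne _ hac.ne⟩
  map_add' _ _ := Subtype.ext (Matrix.diagonal_add _ _).symm
  map_smul' c _ := Subtype.ext (Matrix.diagonal_smul c _)

/-- The endomorphism of the tensor algebra induced by the projection onto the diagonal. -/
def diagHom (l : ℕ) : TAlg l →ₐ[ℂ] TAlg l :=
  TensorAlgebra.lift ℂ (TensorAlgebra.ι ℂ ∘ₗ Finsupp.mapRange.linearMap (diagPart l))

lemma diagHom_ι_single (s : ℕ) (x : glLe l) :
    diagHom l (TensorAlgebra.ι ℂ (Finsupp.single s x))
      = TensorAlgebra.ι ℂ (Finsupp.single s (diagPart l x)) := by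
  simp [diagHom]

lemma diagHom_eT {j i : Fin l} (h : i ≤ j) :
    diagHom l (eT l j i) = if j = i then eT l i i else 0 := by
  rw [eT, dif_pos h, diagHom_ι_single]
  split_ifs with hji
  · subst hji
    rw [eT, dif_pos le_rfl]
    congr 2
    refine Subtype.ext (Matrix.ext fun a c => ?_)
    change Matrix.diagonal (fun a => Matrix.single j j (1 : ℂ) a a) a c = Matrix.single j j 1 a c
    rw [Matrix.diagonal_apply, Matrix.single_apply, Matrix.single_apply]
    grind
  · have h0 : ∀ h, diagPart l ⟨Matrix.single j i 1, h⟩ = 0 := fun _ => by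
      refine Subtype.ext (Matrix.ext fun a c => ?_)
      change Matrix.diagonal (fun a => Matrix.single j i (1 : ℂ) a a) a c = 0
      rw [Matrix.diagonal_apply, Matrix.single_apply]
      grind
    exact (congrArg (fun z => TensorAlgebra.ι ℂ (Finsupp.single 0 z)) (h0 _)).trans (by simp)

lemma diagHom_tauDer (β : ℂ) (u : TAlg l) :
    diagHom l ((tauDer l β).toLin u) = (tauDer l β).toLin (diagHom l u) := by
  induction u using TensorAlgebra.induction with
  | algebraMap c => simp only [Der.map_algebraMap, AlgHom.commutes, map_zero]
  | ι z =>
    induction z using Finsupp.induction_linear with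
    | zero => simp
    | add z z' h h' => simp only [map_add, h, h']
    | single s x =>
      rw [tauDer_ι, map_smul, diagHom_ι_single, diagHom_ι_single, tauDer_ι]
  | mul a b ha hb => simp only [Der.leibniz, map_add, map_mul, ha, hb]
  | add a b ha hb => simp only [map_add, ha, hb]

lemma CoeffRecursion.diag {β c : ℂ} {f : ℕ → ℕ → TAlg l} (hf : CoeffRecursion (eT l) β c f) :
    CoeffRecursion (fun j i => if j = i then eT l i i else 0) β c
      (fun i s => diagHom l (f i s)) where
  last s := by
    rw [hf.last]
    split_ifs
    · exact map_one _
    · exact map_zero _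
  step i s := by
    simp only [hf.step i s, map_add, map_sum, map_mul, map_smul, diagHom_tauDer]
    congr 1
    · refine Finset.sum_congr rfl fun j hj => ?_
      rw [diagHom_eT (Finset.mem_Ici.mp hj)]
    · congr 2
      split_ifs
      · exact map_zero _
      · rfl

lemma inclusion_proj_kron (p q : Fin n) (x : glLe l) :
    LieSubalgebra.inclusion (l_le_b n l) (proj n l (kron n l p q x))
      = kron n l p q (diagPart l x) := by
  refine Subtype.ext (Matrix.ext fun a c => ?_)
  change (if a.1 = c.1 then (x : Matrix (Fin l) (Fin l) ℂ) a.1 c.1 * Matrix.single p q 1 a.2 c.2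
    else 0) = Matrix.diagonal (fun a => (x : Matrix (Fin l) (Fin l) ℂ) a a) a.1 c.1
      * Matrix.single p q 1 a.2 c.2
  rw [Matrix.diagonal_apply]
  split_ifs with h
  · rw [h]
  · rw [zero_mul]

/-- The composition of the maps of affinizations induced by `b → l` and `l → b`. -/
def levelZero (n l : ℕ) (k : ℂ) : AffAlg (formB n l k) →ₐ[ℂ] AffAlg (formB n l k) :=
  (AffAlg.map (κ := formL n l k) (κ' := formB n l k)
    (LieSubalgebra.inclusion (l_le_b n l)) (fun _ _ => rfl)).comp
      (AffAlg.map (proj n l) (form_proj n l k))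

lemma levelZero_mode (x : bAlg n l) (m : ℤ) :
    levelZero n l k (AffAlg.mode _ x m)
      = AffAlg.mode _ (LieSubalgebra.inclusion (l_le_b n l) (proj n l x)) m :=
  (congrArg _ (AffAlg.map_mode (proj n l) (form_proj n l k) x m)).trans
    (AffAlg.map_mode (κ := formL n l k) (κ' := formB n l k)
      (LieSubalgebra.inclusion (l_le_b n l)) (fun _ _ => rfl) _ m)

lemma levelZero_toAff_calT (u : TAlg l) (i j : Fin n) :
    levelZero n l k (UNeg.toAff _ (calT n l u i j))
      = UNeg.toAff (formB n l k) (calT n l (diagHom l u) i j) := by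
  induction u using TensorAlgebra.induction generalizing i j with
  | algebraMap c =>
    rw [AlgHom.commutes (diagHom l), AlgHom.commutes (calT n l), Matrix.algebraMap_matrix_apply]
    split_ifs
    · simp only [AlgHom.commutes]
    · simp only [map_zero]
  | ι z =>
    induction z using Finsupp.induction_linear with
    | zero => simp
    | add z z' h h' => simp only [map_add, Matrix.add_apply, h, h']
    | single s x =>
      rw [diagHom_ι_single, calT_ι_single, calT_ι_single, UNeg.toAff_gen, UNeg.toAff_gen,
        levelZero_mode, inclusion_proj_kron]
  | mul a b ha hb => simp only [map_mul, Matrix.mul_apply, map_sum, ha, hb]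
  | add a b ha hb => simp only [map_add, Matrix.add_apply, ha, hb]

/-- On the images of the tensor algebra, the Miura map is the projection onto the diagonal. -/
lemma inclVl_nu_toVac_calT (u : TAlg l) (i j : Fin n) :
    inclVl n l k (nu n l k (UNeg.toVac (formB n l k) (calT n l u i j)))
      = UNeg.toVac (formB n l k) (calT n l (diagHom l u) i j) := by
  have h1 : ∀ (b : AffAlg (formL n l k)) (w : Vl n l k), inclVl n l k (b • w)
      = AffAlg.map (κ := formL n l k) (κ' := formB n l k)
        (LieSubalgebra.inclusion (l_le_b n l)) (fun _ _ => rfl) b • inclVl n l k w :=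
    fun b w => LQuot.map_smul_alg _ _ _ _ b w
  have h2 : ∀ (a : AffAlg (formB n l k)) (v : Vb n l k),
      nu n l k (a • v) = AffAlg.map (proj n l) (form_proj n l k) a • nu n l k v :=
    fun a v => LQuot.map_smul_alg _ _ _ _ a v
  have h3 : inclVl n l k (nu n l k (VAff.vac _)) = VAff.vac _ :=
    (congrArg _ (VAff.map_vac _ _)).trans (VAff.map_vac (κ := formL n l k) (κ' := formB n l k) _ _)
  rw [UNeg.toVac_apply, UNeg.toVac_apply, ← levelZero_toAff_calT, h2, h1, h3]
  rfl

lemma calTtau_eq_sum {β : ℂ} (P : TauAlg l β) (hP : ∀ s, l < s → Ore.coeff s P = 0)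
    (i j : Fin n) :
    calTtau n l i j P = ∑ r : Fin (l + 1),
      calT n l (Ore.coeff (l - (r : ℕ)) P) i j ⊗ₜ[ℂ]
        ((Polynomial.X : Polynomial ℂ) ^ (l - (r : ℕ))) := by
  have hdeg : (P : Polynomial (TAlg l)).natDegree < l + 1 :=
    Nat.lt_succ_of_le (Polynomial.natDegree_le_iff_coeff_eq_zero.mpr hP)
  rw [calTtau, Polynomial.sum_over_range' _ (by simp) _ hdeg, ← Finset.sum_range_reflect,
    Finset.sum_range]
  rfl

/-- The coefficients of `cdet B` are those with `α τ` treated as a variable, rescaled by powers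
of `α`. -/
lemma coeff_cdet_rescale (β : ℂ) (s : ℕ) :
    Ore.coeff s (cdet l (Bmat l 1 β)) = β ^ s • Ore.coeff s (cdet l (Bmat l β 1)) := by
  obtain ⟨f, hf, hf0⟩ := exists_coeffRecursion_cdet (l := l) 1 β
  obtain ⟨g, hg, hg0⟩ := exists_coeffRecursion_cdet (l := l) β 1
  rw [← hf0, ← hg0]
  exact hf.eq hg.rescale (Nat.zero_le l) s

lemma coeff_diagProd_rescale (β : ℂ) (s : ℕ) :
    Ore.coeff s (diagProd l 1 β) = β ^ s • Ore.coeff s (diagProd l β 1) := by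
  obtain ⟨f, hf, hf0⟩ := exists_coeffRecursion_diagProd (l := l) 1 β
  obtain ⟨g, hg, hg0⟩ := exists_coeffRecursion_diagProd (l := l) β 1
  rw [← hf0, ← hg0]
  exact hf.eq hg.rescale (Nat.zero_le l) s

lemma diagHom_coeff_cdet (β c : ℂ) (s : ℕ) :
    diagHom l (Ore.coeff s (cdet l (Bmat l β c))) = Ore.coeff s (diagProd l β c) := by
  obtain ⟨f, hf, hf0⟩ := exists_coeffRecursion_cdet (l := l) β c
  obtain ⟨g, hg, hg0⟩ := exists_coeffRecursion_diagProd (l := l) β c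
  rw [← hf0, ← hg0]
  exact hf.diag.eq hg (Nat.zero_le l) s

lemma coeff_cdet_eq_zero (β c : ℂ) (s : ℕ) (hs : l < s) :
    Ore.coeff s (cdet l (Bmat l β c)) = 0 := by
  obtain ⟨f, hf, hf0⟩ := exists_coeffRecursion_cdet (l := l) β c
  rw [← hf0]
  exact hf.eq_zero (Nat.zero_le l) (by omega)

lemma coeff_diagProd_eq_zero (β c : ℂ) (s : ℕ) (hs : l < s) :
    Ore.coeff s (diagProd l β c) = 0 := by
  rw [← diagHom_coeff_cdet, coeff_cdet_eq_zero β c s hs, map_zero]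

lemma smul_tmul_X_pow {M : Type*} [AddCommGroup M] [Module ℂ M] (β : ℂ) (s : ℕ) (v : M) :
    (β ^ s • v) ⊗ₜ[ℂ] ((Polynomial.X : Polynomial ℂ) ^ s)
      = v ⊗ₜ[ℂ] ((β • (Polynomial.X : Polynomial ℂ)) ^ s) := by
  rw [smul_pow, TensorProduct.smul_tmul]

lemma inclVl_nu_genWvec (k : ℂ) (i j : Fin n) (r : Fin (l + 1)) :
    inclVl n l k (nu n l k (genWvec n l k i j r)) = UNeg.toVac (formB n l k)
      (calT n l (Ore.coeff (l - (r : ℕ)) (diagProd l (alpha n l k) 1)) i j) := by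
  rw [genWvec, genW, inclVl_nu_toVac_calT, diagHom_coeff_cdet]

end Vectors

end RectW

end

theorem corollary3p2 (n l : ℕ) (hn : 0 < n) (hl : 0 < l) (k : ℂ) (i j : Fin n) :
    -- `T_{ij}(cdet B) = ∑_r W_{ij}^{(r)} (α τ)^{l-r}` with `[τ, x[-m]] = m x[-m-1]`
    RectW.calTtau n l i j (RectW.cdet l (RectW.Bmat l 1 (RectW.alpha n l k)))
        = ∑ r : Fin (l + 1), RectW.genW n l k i j r ⊗ₜ[ℂ]
            ((RectW.alpha n l k • (Polynomial.X : Polynomial ℂ)) ^ (l - (r : ℕ))) ∧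
    -- the same with `α τ` treated as a variable (this says more only when `α = 0`)
    RectW.calTtau n l i j (RectW.cdet l (RectW.Bmat l (RectW.alpha n l k) 1))
        = ∑ r : Fin (l + 1), RectW.genW n l k i j r ⊗ₜ[ℂ]
            ((Polynomial.X : Polynomial ℂ) ^ (l - (r : ℕ))) ∧
    -- the coefficients lie in `W^k(g, f)`, the domain of the Miura transformation `ν`, and
    -- `∑_r ν(W_{ij}^{(r)}) (α τ)^{l-r} = T_{ij}((α τ + e_{11}[-1]) ⋯ (α τ + e_{ll}[-1]))`
    ∃ hW : ∀ r : Fin (l + 1), RectW.genWvec n l k i j r ∈ RectW.W n l k,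
      ∑ r : Fin (l + 1),
          (RectW.inclVl n l k (RectW.miura n l k ⟨RectW.genWvec n l k i j r, hW r⟩)) ⊗ₜ[ℂ]
            ((RectW.alpha n l k • (Polynomial.X : Polynomial ℂ)) ^ (l - (r : ℕ)))
        = (RectW.UNeg.toVac (RectW.formB n l k)).rTensor (Polynomial ℂ)
            (RectW.calTtau n l i j (RectW.diagProd l 1 (RectW.alpha n l k))) ∧
      -- the same with `α τ` treated as a variable
      ∑ r : Fin (l + 1),
          (RectW.inclVl n l k (RectW.miura n l k ⟨RectW.genWvec n l k i j r, hW r⟩)) ⊗ₜ[ℂ]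
            ((Polynomial.X : Polynomial ℂ) ^ (l - (r : ℕ)))
        = (RectW.UNeg.toVac (RectW.formB n l k)).rTensor (Polynomial ℂ)
            (RectW.calTtau n l i j (RectW.diagProd l (RectW.alpha n l k) 1)) := by
  refine ⟨?_, ?_, fun r => RectW.genWvec_mem_W k i j r, ?_, ?_⟩
  · rw [RectW.calTtau_eq_sum _ (RectW.coeff_cdet_eq_zero _ _)]
    refine Finset.sum_congr rfl fun r _ => ?_
    rw [RectW.coeff_cdet_rescale, map_smul, Matrix.smul_apply, RectW.smul_tmul_X_pow, RectW.genW]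
  · exact RectW.calTtau_eq_sum _ (RectW.coeff_cdet_eq_zero _ _) i j
  · rw [RectW.calTtau_eq_sum _ (RectW.coeff_diagProd_eq_zero _ _), map_sum]
    refine Finset.sum_congr rfl fun r _ => ?_
    rw [RectW.coeff_diagProd_rescale, map_smul, Matrix.smul_apply, LinearMap.rTensor_tmul,
      map_smul, RectW.smul_tmul_X_pow, ← RectW.inclVl_nu_genWvec]
    rfl
  · rw [RectW.calTtau_eq_sum _ (RectW.coeff_diagProd_eq_zero _ _), map_sum]
    refine Finset.sum_congr rfl fun r _ => ?_
    rw [LinearMap.rTensor_tmul, ← RectW.inclVl_nu_genWvec]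
    rfl
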